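/- Let $\Gamma$ be a finite ranked alphabet and let $\Sigma$ be a finite input alphabet. The *free term algebra* over $\Gamma$ has as data of type $\tau\in\mathbb N$ the $\tau$-tuples of ground terms over $\Gamma$. An *update* from type $\alpha$ to type $\beta$ is specified by a $\beta$-tuple $\bar c$ of terms over variables $x_1,\dots,x_\alpha$ and maps $\bar t$ to $\bar c[\bar x/\bar t]$. Fix any combination (possibly none) of the following restrictions on updates: *copyless* (every variable occurs at most once in $\bar c$), *non-erasing* (every variable occurs at least once in $\bar c$), *linear* (every variable occurs exactly once and the occurrences, read from left to right, are $x_1,\dots,x_\alpha$). From now on, all updates satisfy the chosen restrictions. A *constrained domain* of type $\tau$ is the solution set $\{d : f(d)=g(d)\ \forall (f,g)\in\gamma\}$ of a set $\gamma$ of pairs of updates with input type $\tau$, each pair having a common output type. The *closure* $\mathrm{cl}(D)$ of a set $D$ of data of type $\tau$ is the smallest constrained domain of type $\tau$ containing $D$. A *configuration space* is given by a set $Q$ of control states, each with a constrained domain $\mathrm{Data}(q)$; its configurations are the pairs $(q,d)$ with $d\in\mathrm{Data}(q)$, and $\mathrm{cl}$ extends to sets of configurations state by state. A *transformation* is a partial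 function between configuration spaces given by a partial map $q\mapsto r$ on control states and, for each $q$ on which it is defined, an update mapping $\mathrm{Data}(q)$ into $\mathrm{Data}(r)$. An *upward STT* $B$ over $\Sigma$ consists of a configuration space $S_B$, an initial transformation $\kappa_\triangleright$ from the one-element space $\{(q_\triangleright,())\}$ (type $0$) to $S_B$, internal transformations $\kappa_a:S_B\rightharpoonup S_B$ for $a\in\Sigma$, and a final transformation $\kappa_\triangleleft$ from $S_B$ to the space with a single state and data of type $1$. It is *finite* if it has finitely many states, and the domain of each state is given by a finite system of equations. Morphisms of upward STTs are the transformations between their configuration spaces that commute with the initial, internal and final transformations. Let $I$ be the initial transducer for the transduction realized by $B$: its states are the words over $\Sigma$ and it has no registers. The unique morphism $I\to B$ maps $w$ to the configuration, if any, reached by $B$ after reading $w$. The *initial image* $\mathrm{Reach}(B)$ is the image of this morphism, that is, the middle object $C$ of its factorization $I\to C\to B$ into an epi morphism followed by a strong mono morphism, where epi and strong mono are understood in the category of configuration spaces and transformations. It is unique up to isomorphism. **Statement.** Given a finite upward STT $B$, one can compute its initial image $\mathrm{Reach}(B)$. More precisely, there is a computable function, uniform in $\Gamma$, $\Sigma$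 and $B$, that maps (the code of) each finite upward STT $B$ to (the code of) a finite upward STT $C$ over the same alphabets which, up to an injective renaming of control states, is the following restriction of $B$ and is the initial image of $B$: its states are the control states that $B$ reaches; the domain of each such state $q$ is the closure of the set of data with which $B$ reaches $q$; $I\to B$ factors as an epi morphism $I\to C$ followed by the inclusion $C\to B$, which is a strong mono morphism. Moreover, for every finite upward STT $B$, the closure of its set of reachable configurations is the least fixpoint of $$F(S)=\mathrm{cl}\Big(S\cup\{\kappa_\triangleright(q_\triangleright,())\}\cup\bigcup_{a\in\Sigma}\kappa_a(S)\Big)$$ (where the initial configuration is omitted if undefined), and it is reached by the iteration $\emptyset, F(\emptyset), F(F(\emptyset)),\dots$ after finitely many steps. -/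

import Mathlib

namespace UpwardSTT

/-! ### Terms over a ranked alphabet -/

/-- A finite ranked alphabet: symbols `0, …, size - 1`, each with a rank. -/
structure RankedAlphabet where
  size : ℕ
  arity : Fin size → ℕ

/-- Terms over `Γ` and the variables `x_0, …, x_{n-1}`. -/
inductive Term (Γ : RankedAlphabet) (n : ℕ) : Type
  | var (i : Fin n) : Term Γ n
  | app (f : Fin Γ.size) (args : Fin (Γ.arity f) → Term Γ n) : Term Γ n

/-- Ground terms, that is, terms without variables. -/
abbrev GroundTerm (Γ : RankedAlphabet) : Type := Term Γ 0

/-- Simultaneous substitution of the terms `u i` for the variables `x_i`. -/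
def Term.subst {Γ : RankedAlphabet} {n m : ℕ} (u : Fin n → Term Γ m) : Term Γ n → Term Γ m
  | .var i => u i
  | .app f args => .app f fun j => (args j).subst u

/-- The variable occurrences of a term, from left to right. -/
def Term.vars {Γ : RankedAlphabet} {n : ℕ} : Term Γ n → List (Fin n)
  | .var i => [i]
  | .app _ args => (List.ofFn fun j => (args j).vars).flatten

/-- The standard code of a term as a natural number, built from the standard codes of sums, pairs
and lists: a variable is coded by its index, and `f(t_1, …, t_k)` by `f` and the list of codes of
`t_1, …, t_k`. -/
def Term.code {Γ : RankedAlphabet} {n : ℕ} : Term Γ n → ℕ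
  | .var i => Encodable.encode (Sum.inl (i : ℕ) : ℕ ⊕ (ℕ × List ℕ))
  | .app f args =>
      Encodable.encode (Sum.inr ((f : ℕ), List.ofFn fun j => (args j).code) : ℕ ⊕ (ℕ × List ℕ))

/-! ### The free term algebra: data, updates, constraints, closures -/

/-- The data of numeric type `τ`: the `τ`-tuples of ground terms. -/
abbrev Data (Γ : RankedAlphabet) (τ : ℕ) : Type := Fin τ → GroundTerm Γ

/-- A choice of restrictions on the updates of the free term algebra (any combination). -/
structure UpdateClass where
  copyless : Bool
  nonErasing : Bool
  linear : Bool

/-- The restrictions, as conditions on the left-to-right list `l` of all variable occurrences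
in a tuple of terms over `x_0, …, x_{α-1}`. -/
def UpdateClass.Admits (U : UpdateClass) {α : ℕ} (l : List (Fin α)) : Prop :=
  (U.copyless = true → l.Nodup) ∧
  (U.nonErasing = true → ∀ i, i ∈ l) ∧
  (U.linear = true → l = List.finRange α)

/-- An update of type `α → β`, specified by a `β`-tuple of terms over `α` variables. -/
structure Update (Γ : RankedAlphabet) (U : UpdateClass) (α β : ℕ) where
  terms : Fin β → Term Γ α
  admits : U.Admits (List.ofFn fun j => (terms j).vars).flatten

/-- The function on data induced by an update. -/
def Update.eval {Γ : RankedAlphabet} {U : UpdateClass} {α β : ℕ} (u : Update Γ U α β)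
    (d : Data Γ α) : Data Γ β :=
  fun j => (u.terms j).subst d

def Update.code {Γ : RankedAlphabet} {U : UpdateClass} {α β : ℕ} (u : Update Γ U α β) : List ℕ :=
  List.ofFn fun j => (u.terms j).code

/-- The update of type `0 → β` that maps the empty tuple to `d`. -/
def Update.const {Γ : RankedAlphabet} (U : UpdateClass) {β : ℕ} (d : Data Γ β) :
    Update Γ U 0 β where
  terms := d
  admits := by
    have h : (List.ofFn fun j => (d j).vars).flatten = [] :=
      List.eq_nil_iff_forall_not_mem.2 fun i _ => i.elim0
    rw [h]
    exact ⟨fun _ => List.nodup_nil, fun _ i => i.elim0, fun _ => rfl⟩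

/-- An equation `f(x) = g(x)` on data of type `τ`, between two updates. -/
structure Equation (Γ : RankedAlphabet) (U : UpdateClass) (τ : ℕ) where
  width : ℕ
  lhs : Update Γ U τ width
  rhs : Update Γ U τ width

def Equation.Holds {Γ : RankedAlphabet} {U : UpdateClass} {τ : ℕ} (e : Equation Γ U τ)
    (d : Data Γ τ) : Prop :=
  e.lhs.eval d = e.rhs.eval d

def Equation.code {Γ : RankedAlphabet} {U : UpdateClass} {τ : ℕ} (e : Equation Γ U τ) :
    List ℕ × List ℕ :=
  (e.lhs.code, e.rhs.code)

/-- The solution set of a constraint, i.e. of a possibly infinite set of equations. -/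
def Sol {Γ : RankedAlphabet} {U : UpdateClass} {τ : ℕ} (γ : Set (Equation Γ U τ)) :
    Set (Data Γ τ) :=
  {d | ∀ e ∈ γ, e.Holds d}

/-- The closure of a set of data: the solution set of all the equations valid on it. -/
def cl {Γ : RankedAlphabet} (U : UpdateClass) {τ : ℕ} (D : Set (Data Γ τ)) : Set (Data Γ τ) :=
  Sol {e : Equation Γ U τ | ∀ d ∈ D, e.Holds d}

/-! ### Configuration spaces and transformations -/

/-- A set of control states, each with a constrained type: a numeric type and a constraint. The
unconstrained types are those with the empty constraint. -/
structure Space (Γ : RankedAlphabet) (U : UpdateClass) where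
  State : Type
  rank : State → ℕ
  constraint : (q : State) → Set (Equation Γ U (rank q))

/-- The (constrained) data domain of a control state. -/
def Space.data {Γ : RankedAlphabet} {U : UpdateClass} (X : Space Γ U) (q : X.State) :
    Set (Data Γ (X.rank q)) :=
  Sol (X.constraint q)

/-- The configurations `(q, d)`, with `d` in the data domain of `q`. -/
def Space.Config {Γ : RankedAlphabet} {U : UpdateClass} (X : Space Γ U) : Type :=
  Σ q : X.State, {d : Data Γ (X.rank q) // d ∈ X.data q}

/-- The closure of a set of configurations, taken separately at each control state. -/
def Space.closure {Γ : RankedAlphabet} {U : UpdateClass} (X : Space Γ U) (S : Set X.Config) :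
    Set X.Config :=
  {x | x.2.1 ∈ cl U {d | ∃ h : d ∈ X.data x.1, (⟨x.1, d, h⟩ : X.Config) ∈ S}}

/-- The specification of a transformation: a partial function on control states, together with
an update, compatible with the data domains, for each state where that function is defined. -/
structure Transf {Γ : RankedAlphabet} {U : UpdateClass} (X Y : Space Γ U) where
  move : (q : X.State) → Option (Σ r : Y.State,
    {u : Update Γ U (X.rank q) (Y.rank r) // ∀ d ∈ X.data q, u.eval d ∈ Y.data r})

/-- The partial function on configurations induced by a specification. Two transformations are
regarded as equal when these partial functions are. -/
def Transf.apply {Γ : RankedAlphabet} {U : UpdateClass} {X Y : Space Γ U} (f : Transf X Y)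
    (x : X.Config) : Option Y.Config :=
  (f.move x.1).map fun m => ⟨m.1, m.2.1.eval x.2.1, m.2.2 _ x.2.2⟩

/-- Composition, in diagrammatic order, as partial functions. -/
def Transf.comp {Γ : RankedAlphabet} {U : UpdateClass} {X Y Z : Space Γ U} (f : Transf X Y)
    (g : Transf Y Z) (x : X.Config) : Option Z.Config :=
  (f.apply x).bind g.apply

/-- Epis, in the category of transformations between constrained configuration spaces. -/
def Transf.IsEpi {Γ : RankedAlphabet} {U : UpdateClass} {X Y : Space Γ U}
    (f : Transf X Y) : Prop :=
  ∀ (Z : Space Γ U) (h h' : Transf Y Z), f.comp h = f.comp h' → h.apply = h'.apply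

/-- Strong monos, defined by the diagonal fill-in property, in the category of transformations
between constrained configuration spaces. -/
def Transf.IsStrongMono {Γ : RankedAlphabet} {U : UpdateClass} {Z W : Space Γ U}
    (g : Transf Z W) : Prop :=
  ∀ (X Y : Space Γ U) (f : Transf X Y) (h : Transf X Z) (h' : Transf Y W), f.IsEpi →
    f.comp h' = h.comp g →
      (∃ d : Transf Y Z, h.apply = f.comp d ∧ h'.apply = d.comp g) ∧
      ∀ d d' : Transf Y Z, h.apply = f.comp d → h'.apply = d.comp g →
        h.apply = f.comp d' → h'.apply = d'.comp g → d.apply = d'.apply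

/-! ### Transducers -/

/-- A space with finitely many control states, all with finite systems of equations. -/
structure FinSpace (Γ : RankedAlphabet) (U : UpdateClass) where
  card : ℕ
  rank : Fin card → ℕ
  eqs : (q : Fin card) → List (Equation Γ U (rank q))

abbrev FinSpace.toSpace {Γ : RankedAlphabet} {U : UpdateClass} (X : FinSpace Γ U) :
    Space Γ U where
  State := Fin X.card
  rank := X.rank
  constraint q := {e | e ∈ X.eqs q}

/-- The initial space: one state, of type `0`; its only datum is the empty tuple. -/
abbrev initSpace (Γ : RankedAlphabet) (U : UpdateClass) : FinSpace Γ U where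
  card := 1
  rank _ := 0
  eqs _ := []

/-- The final space: one state, of type `1`; its data are the possible outputs. -/
abbrev haltSpace (Γ : RankedAlphabet) (U : UpdateClass) : FinSpace Γ U where
  card := 1
  rank _ := 1
  eqs _ := []

/-- The only configuration of the initial space. -/
def initConfig (Γ : RankedAlphabet) (U : UpdateClass) : (initSpace Γ U).toSpace.Config :=
  ⟨(0 : Fin 1), Fin.elim0, fun _ he => absurd he List.not_mem_nil⟩

/-- Upward string-to-term transducers over the input alphabet `A`, with an arbitrary set of
control states: transducers over the free term algebra over `Γ`. -/
structure Transducer (Γ : RankedAlphabet) (U : UpdateClass) (A : Type) where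
  space : Space Γ U
  init : Transf (initSpace Γ U).toSpace space
  step : A → Transf space space
  halt : Transf space (haltSpace Γ U).toSpace

/-- The configuration, if any, reached after reading an input word. -/
def Transducer.reach {Γ : RankedAlphabet} {U : UpdateClass} {A : Type} (B : Transducer Γ U A)
    (w : List A) : Option B.space.Config :=
  w.foldl (fun x a => x.bind (B.step a).apply) (B.init.apply (initConfig Γ U))

/-- The transduction realized by a transducer. -/
def Transducer.transduction {Γ : RankedAlphabet} {U : UpdateClass} {A : Type}
    (B : Transducer Γ U A) (w : List A) : Option (Data Γ 1) :=
  ((B.reach w).bind B.halt.apply).map fun x => x.2.1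

/-- Transducer morphisms: transformations that commute with the initial, internal and final
transformations. -/
def Transf.IsMorphism {Γ : RankedAlphabet} {U : UpdateClass} {A : Type} {B C : Transducer Γ U A}
    (h : Transf B.space C.space) : Prop :=
  B.init.comp h = C.init.apply ∧
  (∀ a, (B.step a).comp h = h.comp (C.step a)) ∧
  B.halt.apply = h.comp C.halt

/-- The initial transducer for a transduction `φ`: its states are the input words, it has no
registers, and it outputs `φ w` at `w`. -/
def initialTransducer {Γ : RankedAlphabet} (U : UpdateClass) {A : Type}
    (φ : List A → Option (Data Γ 1)) : Transducer Γ U A where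
  space :=
    { State := List A
      rank := fun _ => 0
      constraint := fun _ => ∅ }
  init := ⟨fun _ => some ⟨[], Update.const U Fin.elim0, fun _ _ _ he => absurd he id⟩⟩
  step a := ⟨fun w => some ⟨w ++ [a], Update.const U Fin.elim0, fun _ _ _ he => absurd he id⟩⟩
  halt := ⟨fun w => (φ w).map fun d =>
    ⟨(0 : Fin 1), Update.const U d, fun _ _ _ he => absurd he List.not_mem_nil⟩⟩

/-- The unique morphism to `B` from the initial transducer for the transduction of `B`, as a
partial function on configurations: it maps a word to the configuration that `B` reaches on it. -/
def Transducer.initialArrow {Γ : RankedAlphabet} {U : UpdateClass} {A : Type}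
    (B : Transducer Γ U A) (x : (initialTransducer U B.transduction).space.Config) :
    Option B.space.Config :=
  B.reach x.1

/-- The reachable configurations. -/
def Transducer.reachable {Γ : RankedAlphabet} {U : UpdateClass} {A : Type}
    (B : Transducer Γ U A) : Set B.space.Config :=
  {x | ∃ w, B.reach w = some x}

/-- The operator `S ↦ cl(S ∪ {initial configuration} ∪ ⋃ₐ δₐ(S))` on sets of configurations. -/
def Transducer.invariantStep {Γ : RankedAlphabet} {U : UpdateClass} {A : Type}
    (B : Transducer Γ U A) (S : Set B.space.Config) : Set B.space.Config :=
  B.space.closure (S ∪ {x | B.init.apply (initConfig Γ U) = some x} ∪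
    {x | ∃ a, ∃ y ∈ S, (B.step a).apply y = some x})

/-- `C` is the image of the morphism from the initial transducer to `B`, obtained as a restriction
of `B`: that morphism factors as an epi morphism `e` to `C` followed by a strong mono morphism `m`
from `C` to `B`. Moreover `m` is the inclusion, up to an injective renaming `ι` of control states:
it leaves the data tuples unchanged, the states of `C` are those that `B` reaches, and the
configurations of `C` are those in the closure of the set of reachable ones. -/
def IsInitialImage {Γ : RankedAlphabet} {U : UpdateClass} {A : Type}
    (C B : Transducer Γ U A) : Prop :=
  ∃ (e : Transf (initialTransducer U B.transduction).space C.space)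
    (m : Transf C.space B.space) (ι : C.space.State → B.space.State),
    e.IsMorphism (C := C) ∧ m.IsMorphism (B := C) (C := B) ∧
    e.IsEpi ∧ m.IsStrongMono ∧ e.comp m = B.initialArrow ∧
    Function.Injective ι ∧
    Set.range ι = {q | ∃ x ∈ B.reachable, x.1 = q} ∧
    (∀ x, ∃ y, m.apply x = some y ∧ y.1 = ι x.1 ∧ List.ofFn y.2.1 = List.ofFn x.2.1) ∧
    {y | ∃ x, m.apply x = some y} =
      {y | y ∈ B.space.closure B.reachable ∧ ∃ x ∈ B.reachable, x.1 = y.1}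

/-! ### Finite transducers and their codes -/

/-- Finite upward string-to-term transducers over the input alphabet `{0, …, s - 1}`, possibly with
constrained data domains, which are given by finite systems of equations. -/
structure FinTransducer (Γ : RankedAlphabet) (U : UpdateClass) (s : ℕ) where
  space : FinSpace Γ U
  init : Transf (initSpace Γ U).toSpace space.toSpace
  step : Fin s → Transf space.toSpace space.toSpace
  halt : Transf space.toSpace (haltSpace Γ U).toSpace

def FinTransducer.toTransducer {Γ : RankedAlphabet} {U : UpdateClass} {s : ℕ}
    (B : FinTransducer Γ U s) : Transducer Γ U (Fin s) where
  space := B.space.toSpace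
  init := B.init
  step := B.step
  halt := B.halt

/-- For each state, its numeric type and its system of equations. -/
abbrev SpaceCode : Type := List (ℕ × List (List ℕ × List ℕ))

/-- For each state, if defined, the target state and the tuple of terms of the update. -/
abbrev TransfCode : Type := List (Option (ℕ × List ℕ))

/-- The ranks of the output symbols, the space, and the initial, internal (one for each input
letter) and final transformations. -/
abbrev TransducerCode : Type :=
  List ℕ × SpaceCode × TransfCode × List TransfCode × TransfCode

def FinSpace.code {Γ : RankedAlphabet} {U : UpdateClass} (X : FinSpace Γ U) : SpaceCode :=
  List.ofFn fun q => (X.rank q, (X.eqs q).map Equation.code)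

def Transf.code {Γ : RankedAlphabet} {U : UpdateClass} {X Y : FinSpace Γ U}
    (f : Transf X.toSpace Y.toSpace) : TransfCode :=
  List.ofFn fun q : Fin X.card => (f.move q).map fun m => (Fin.val m.1, m.2.1.code)

def FinTransducer.code {Γ : RankedAlphabet} {U : UpdateClass} {s : ℕ}
    (B : FinTransducer Γ U s) : TransducerCode :=
  (List.ofFn Γ.arity, B.space.code, B.init.code, List.ofFn fun a => (B.step a).code, B.halt.code)

end UpwardSTT

namespace UpwardSTT

/-! ### Recursion on codes of terms -/

/-! The crux is that a single datum bounds all equations that matter. If an equation between tuples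
of terms holds on a ground tuple `d`, peeling off common root symbols breaks it into pairs that
agree on `d` and in which one side is a variable `x_i` (`exists_decomposition`). The other side is
then a term whose value at `d` is `d_i`, that is, `d_i` with some subterms replaced by variables, so
it ranges over a finite computable set (`mem_preimageCodes`). Peeling keeps the sequence of variable
occurrences on each side, so the pairs, taken together as one equation, still obey the restrictions
on updates. Hence, up to equivalence, only finitely many equations hold on `d`, and they can be
listed (`exists_mem_equationCodes`).

Every reachable state is reached by a word no longer than the number of states. One datum at each
such state yields a finite pool containing, up to equivalence, every equation that can hold on all
reachable data there. Updates compose, so equations pull back along them and transformations are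
continuous for the closure. Therefore the iterates of the operator are the closures of the sets
reached within n letters, and two equal consecutive closures make the chain constant. Once all
reachable states have been seen, each strict growth refutes a pool equation, so the number of states
plus the size of the pool bounds the number of letters needed
(`closure_reachedWithin_eq_closure_reachable`). The pool equations that survive define the closure
(`exists_equations_domainCodes`).

On the categorical side, a transformation is epi exactly when its image meets every inhabited state
and its closure is everything, and inclusions of restrictions have the diagonal fill-in property
(`Transf.isStrongMono_incl`). Hence restricting to the closure of the reachable configurations gives
the factorization (`isInitialImage_restrict`). Computability follows from primitive recursion on
codes of terms, because the code of a term exceeds those of its arguments. -/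

theorem lt_encode_of_mem {k : ℕ} : ∀ {l : List ℕ}, k ∈ l → k < Encodable.encode l
  | a :: l, h => by
    rw [Encodable.encode_list_cons, Encodable.encode_nat]
    rcases List.mem_cons.1 h with rfl | h
    · exact Nat.lt_succ_of_le (Nat.left_le_pair _ _)
    · exact (lt_encode_of_mem h).trans_le ((Nat.right_le_pair _ _).trans (Nat.le_succ _))

/-- The code of the variable `x_i`. -/
def varCode (i : ℕ) : ℕ := Encodable.encode (Sum.inl i : ℕ ⊕ (ℕ × List ℕ))

/-- The code of `f(t_1, …, t_k)`, from `f` and the list of codes of `t_1, …, t_k`. -/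
def appCode (f : ℕ) (l : List ℕ) : ℕ := Encodable.encode (Sum.inr (f, l) : ℕ ⊕ (ℕ × List ℕ))

theorem lt_appCode {f k : ℕ} {l : List ℕ} (h : k ∈ l) : k < appCode f l := by
  have h1 := lt_encode_of_mem h
  have h2 : appCode f l = 2 * Nat.pair f (Encodable.encode l) + 1 := rfl
  have h3 := Nat.right_le_pair f (Encodable.encode l)
  omega

/-- Recursion on the structure of the term coded by a number. -/
def codeRec {σ : Type*} (v : ℕ → σ) (h : ℕ × List ℕ → List σ → σ) (n : ℕ) : σ :=
  -- `decode₂` succeeds only on genuine codes, so in the last case `n` is the code of the decoded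
  -- pair and bounds every entry of its list.
  match _hn : (Encodable.decode₂ (ℕ ⊕ (ℕ × List ℕ)) n) with
  | none => v 0
  | some (.inl i) => v i
  | some (.inr p) => h p (p.2.attach.map fun k => codeRec v h k.1)
termination_by n
decreasing_by
  have h1 := Encodable.mem_decode₂.1 _hn
  exact (lt_appCode (f := p.1) k.2).trans_le h1.le

theorem codeRec_varCode {σ : Type*} (v : ℕ → σ) (h : ℕ × List ℕ → List σ → σ) (i : ℕ) :
    codeRec v h (varCode i) = v i := by
  have h1 := Encodable.decode₂_encode (Sum.inl i : ℕ ⊕ (ℕ × List ℕ))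
  rw [codeRec]
  split <;> simp_all [varCode]

theorem codeRec_appCode {σ : Type*} (v : ℕ → σ) (h : ℕ × List ℕ → List σ → σ) (f : ℕ)
    (l : List ℕ) : codeRec v h (appCode f l) = h (f, l) (l.map (codeRec v h)) := by
  have h1 := Encodable.decode₂_encode (Sum.inr (f, l) : ℕ ⊕ (ℕ × List ℕ))
  rw [codeRec]
  split
  · simp_all [appCode]
  · simp_all [appCode]
  · rename_i p hn
    rw [appCode, h1] at hn
    obtain rfl : (f, l) = p := by simpa using hn
    simp

/-- Course-of-values recursion: the values at all smaller numbers are available as a list, and a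
child's code is an index into it. Children have smaller codes, so the default in the lookup is never
used. -/
theorem primrec_codeRec {α σ : Type*} [Primcodable α] [Primcodable σ] {v : α → ℕ → σ}
    {h : α → ℕ × List ℕ → List σ → σ} (hv : Primrec₂ v)
    (hh : Primrec fun x : α × (ℕ × List ℕ) × List σ => h x.1 x.2.1 x.2.2) :
    Primrec₂ fun a n => codeRec (v a) (h a) n := by
  have hnode : Primrec₂ fun (x : α × List σ) (y : ℕ ⊕ (ℕ × List ℕ)) =>
      (Sum.casesOn y (fun i => v x.1 i)
        fun p => h x.1 p (p.2.map fun k => x.2[k]?.getD (v x.1 0)) : σ) := by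
    refine Primrec.sumCasesOn (Primrec.snd (α := α × List σ))
      (hv.comp₂ (Primrec.fst.comp (Primrec.fst.comp Primrec.fst)).to₂ Primrec₂.right)
      (hh.comp (g := fun z : ((α × List σ) × (ℕ ⊕ (ℕ × List ℕ))) × (ℕ × List ℕ) =>
        (z.1.1.1, z.2, z.2.2.map fun k => z.1.1.2[k]?.getD (v z.1.1.1 0))) ?_).to₂
    refine (Primrec.fst.comp (Primrec.fst.comp Primrec.fst)).pair (Primrec.snd.pair ?_)
    refine Primrec.list_map (Primrec.snd.comp Primrec.snd) ?_
    have hc : Primrec fun z : (((α × List σ) × (ℕ ⊕ (ℕ × List ℕ))) × (ℕ × List ℕ)) × ℕ =>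
        z.1.1.1 := Primrec.fst.comp (Primrec.fst.comp Primrec.fst)
    exact (Primrec.option_getD.comp
      (Primrec.list_getElem?.comp (Primrec.snd.comp hc) Primrec.snd)
      (hv.comp (Primrec.fst.comp hc) (Primrec.const 0))).to₂
  have hg : Primrec₂ fun (a : α) (prev : List σ) => some
      ((Option.casesOn (Encodable.decode₂ (ℕ ⊕ (ℕ × List ℕ)) prev.length) (v a 0)
        fun y => Sum.casesOn y (fun i => v a i)
          fun p => h a p (p.2.map fun k => prev[k]?.getD (v a 0))) : σ) := by
    refine Primrec.option_some.comp₂ ?_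
    refine Primrec.option_casesOn
      (Primrec.decode₂.comp (Primrec.list_length.comp Primrec.snd))
      (hv.comp Primrec.fst (Primrec.const 0)) ?_
    exact (hnode.comp Primrec.fst Primrec.snd).to₂
  refine Primrec.nat_strong_rec _ hg fun a n => ?_
  simp only [List.length_map, List.length_range]
  rcases hd : Encodable.decode₂ (ℕ ⊕ (ℕ × List ℕ)) n with _ | ⟨i | ⟨f, l⟩⟩
  · rw [codeRec]
    split <;> simp_all
  · obtain rfl : varCode i = n := Encodable.mem_decode₂.1 hd
    simp [codeRec_varCode]
  · obtain rfl : appCode f l = n := Encodable.mem_decode₂.1 hd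
    rw [codeRec_appCode]
    refine congrArg some (congrArg (h a (f, l)) (List.map_congr_left fun k hk => ?_))
    have hlt := lt_appCode (f := f) hk
    simp [hlt]

theorem primrec_varCode : Primrec varCode := Primrec.encode.comp Primrec.sumInl

theorem primrec_appCode : Primrec₂ appCode :=
  (Primrec.encode.comp Primrec.sumInr).to₂

/-! ### Operations on codes of terms -/

/-- The code of `t[x/d]`, from the codes of `d` and `t`. -/
def substCode (d : List ℕ) : ℕ → ℕ :=
  codeRec (fun i => d[i]?.getD 0) fun p r => appCode p.1 r

theorem primrec_substCode : Primrec₂ substCode := by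
  refine primrec_codeRec (v := fun (d : List ℕ) i => d[i]?.getD 0)
    (h := fun _ (p : ℕ × List ℕ) r => appCode p.1 r) ?_ ?_
  · exact Primrec.option_getD.comp₂ Primrec.list_getElem? (Primrec₂.const 0)
  · exact primrec_appCode.comp (Primrec.fst.comp (Primrec.fst.comp Primrec.snd))
      (Primrec.snd.comp Primrec.snd)

/-- The indices of the variables of a term, from left to right. -/
def varsCode : ℕ → List ℕ := codeRec (fun i => [i]) fun _ r => r.flatten

theorem primrec_varsCode : Primrec varsCode := by
  refine (primrec_codeRec (α := Unit) (v := fun _ i => [i])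
    (h := fun _ (_ : ℕ × List ℕ) r => r.flatten) ?_ ?_).comp (Primrec.const ()) Primrec.id
  · exact Primrec.list_cons.comp₂ Primrec₂.right (Primrec₂.const [])
  · exact Primrec.list_flatten.comp (Primrec.snd.comp Primrec.snd)

theorem primrec_sections {α : Type*} [Primcodable α] : Primrec (@List.sections α) := by
  have h1 : Primrec₂ fun (x : List α × List (List α)) (s : List α) => x.1.map fun a => a :: s :=
    Primrec.list_map (Primrec.fst.comp Primrec.fst)
      (Primrec.list_cons.comp Primrec.snd (Primrec.snd.comp Primrec.fst))
  have h2 : Primrec fun x : List α × List (List α) =>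
      x.2.flatMap fun s => x.1.map fun a => a :: s := Primrec.list_flatMap Primrec.snd h1
  have h : Primrec fun L : List (List α) => L.foldr
      (fun l acc => acc.flatMap fun s => l.map fun a => a :: s) [[]] :=
    Primrec.list_foldr Primrec.id (Primrec.const [[]]) (h2.comp₂ Primrec₂.right)
  refine h.of_eq fun L => ?_
  induction L with
  | nil => rfl
  | cons l L ih => rw [List.foldr_cons, ih]; rfl

/-- The codes of the terms `t` with `t[x/d] = g`, from the codes of `d` and `g`. -/
def preimageCodes (d : List ℕ) (g : ℕ) : List ℕ :=
  -- A preimage of `f(g_1, …, g_k)` is a variable whose value is this whole term, or has root `f`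
  -- and preimages of the `g_j` as arguments; `sections` enumerates the choices of one preimage per
  -- argument. The variable case is immaterial, since `g` is ground.
  codeRec (σ := List ℕ) (fun _ => []) (fun p r =>
    (((List.range d.length).filter fun i => d[i]? = some (appCode p.1 p.2)).map varCode) ++
      r.sections.map (appCode p.1)) g

theorem primrec_filter {α β : Type*} [Primcodable α] [Primcodable β] {f : α → List β}
    {p : α → β → Prop} [∀ a, DecidablePred (p a)] (hf : Primrec f) (hp : PrimrecRel p) :
    Primrec fun a => (f a).filter fun b => p a b := by
  have h : Primrec fun a => (f a).filterMap fun b => if p a b then some b else none := by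
    refine Primrec.listFilterMap hf ?_
    exact Primrec.ite hp (Primrec.option_some.comp Primrec.snd) (Primrec.const none)
  refine h.of_eq fun a => ?_
  rw [← List.filterMap_eq_filter]
  congr 1
  funext b
  simp [Option.guard]

theorem primrec_preimageCodes : Primrec₂ preimageCodes := by
  refine primrec_codeRec (v := fun (_ : List ℕ) (_ : ℕ) => ([] : List ℕ))
    (h := fun (d : List ℕ) (p : ℕ × List ℕ) (r : List (List ℕ)) =>
    (((List.range d.length).filter fun i => d[i]? = some (appCode p.1 p.2)).map varCode) ++
      r.sections.map (appCode p.1)) (Primrec₂.const []) ?_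
  refine Primrec.list_append.comp (Primrec.list_map (primrec_filter
    (Primrec.list_range.comp (Primrec.list_length.comp Primrec.fst)) ?_)
    (primrec_varCode.comp₂ Primrec₂.right))
    (Primrec.list_map (primrec_sections.comp (Primrec.snd.comp Primrec.snd)) ?_)
  · refine (Primrec.eq.comp (Primrec.list_getElem?.comp (Primrec.fst.comp Primrec.fst) Primrec.snd)
      (Primrec.option_some.comp (primrec_appCode.comp ?_ ?_)))
    · exact Primrec.fst.comp (Primrec.fst.comp (Primrec.snd.comp Primrec.fst))
    · exact Primrec.snd.comp (Primrec.fst.comp (Primrec.snd.comp Primrec.fst))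
  · exact primrec_appCode.comp₂
      (Primrec.fst.comp (Primrec.fst.comp (Primrec.snd.comp Primrec.fst))).to₂ Primrec₂.right

/-! ### The computation of the initial image, on codes -/

/-- The lists of length at most `n` with elements in `P`. -/
def boundedLists {α : Type*} (P : List α) (n : ℕ) : List (List α) :=
  (fun acc => [] :: acc.flatMap fun l => P.map fun a => a :: l)^[n] [[]]

theorem mem_boundedLists {α : Type*} {P : List α} {n : ℕ} {l : List α} :
    l ∈ boundedLists P n ↔ l.length ≤ n ∧ ∀ x ∈ l, x ∈ P := by
  induction n generalizing l with
  | zero => cases l <;> simp [boundedLists]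
  | succ n ih =>
    rw [boundedLists, Function.iterate_succ_apply', ← boundedLists]
    cases l with
    | nil => simp
    | cons a l =>
      simp only [List.mem_cons, List.mem_flatMap, List.mem_map, ih]
      simp
      tauto

theorem primrec_boundedLists {α : Type*} [Primcodable α] : Primrec₂ (@boundedLists α) := by
  have h1 : Primrec₂ fun (x : (List α × ℕ) × List (List α)) (l : List α) =>
      x.1.1.map fun a => a :: l :=
    Primrec.list_map (Primrec.fst.comp (Primrec.fst.comp Primrec.fst))
      (Primrec.list_cons.comp Primrec.snd (Primrec.snd.comp Primrec.fst))
  have h2 : Primrec₂ fun (x : List α × ℕ) (acc : List (List α)) =>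
      [] :: acc.flatMap fun l => x.1.map fun a => a :: l :=
    Primrec.list_cons.comp (Primrec.const []) (Primrec.list_flatMap Primrec.snd h1)
  exact Primrec.nat_iterate Primrec.snd (Primrec.const [[]]) h2

theorem primrecRel_forall_lt {α : Type*} [Primcodable α] {R : ℕ → α → Prop} (hR : PrimrecRel R) :
    PrimrecRel fun (n : ℕ) (y : α) => ∀ x < n, R x y :=
  (hR.forall_mem_list.comp (Primrec.list_range.comp Primrec.fst) Primrec.snd).of_eq (by simp)

theorem primrecPred_nodup : PrimrecPred fun l : List ℕ => l.Nodup := by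
  have h1 : PrimrecRel fun (j : ℕ) (x : ℕ × List ℕ) => j = x.1 ∨ ¬ x.2[j]? = x.2[x.1]? := by
    refine PrimrecPred.or (Primrec.eq.comp Primrec.fst (Primrec.fst.comp Primrec.snd))
      (PrimrecPred.not (Primrec.eq.comp ?_ ?_))
    · exact Primrec.list_getElem?.comp (Primrec.snd.comp Primrec.snd) Primrec.fst
    · exact Primrec.list_getElem?.comp (Primrec.snd.comp Primrec.snd)
        (Primrec.fst.comp Primrec.snd)
  have h2 : PrimrecRel fun (i : ℕ) (l : List ℕ) => ∀ j < l.length, j = i ∨ ¬ l[j]? = l[i]? :=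
    (primrecRel_forall_lt h1).comp (Primrec.list_length.comp Primrec.snd) Primrec.id
  refine ((primrecRel_forall_lt h2).comp Primrec.list_length Primrec.id).of_eq fun l => ?_
  rw [List.nodup_iff_injective_getElem]
  constructor
  · intro h i j hij
    have hij : l[i.1] = l[j.1] := hij
    rcases h j j.2 i i.2 with h | h
    · exact Fin.ext h
    · exact absurd (by simp [hij]) h
  · intro h i hi j hj
    by_cases hij : j = i
    · exact Or.inl hij
    · refine Or.inr fun h' => hij ?_
      have hi' : i < l.length := hi
      change l[j]? = l[i]? at h'
      change j < l.length at hj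
      rw [List.getElem?_eq_getElem hj, List.getElem?_eq_getElem hi'] at h'
      exact congrArg Fin.val (@h ⟨j, hj⟩ ⟨i, hi'⟩ (Option.some.inj h'))

/-- `UpdateClass.Admits`, on lists of indices of variables. -/
def UpdateClass.AdmitsCode (U : UpdateClass) (n : ℕ) (l : List ℕ) : Prop :=
  (U.copyless = true → l.Nodup) ∧
  (U.nonErasing = true → ∀ i < n, i ∈ l) ∧
  (U.linear = true → l = List.range n)

instance (U : UpdateClass) (n : ℕ) (l : List ℕ) : Decidable (U.AdmitsCode n l) := by
  unfold UpdateClass.AdmitsCode; infer_instance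

/-- The premise is independent of the input: it serves for the flags of the update class, which is
fixed before the computable function is chosen. -/
theorem primrecPred_imp {α : Type*} [Primcodable α] {p : Prop} {q : α → Prop}
    (hq : PrimrecPred q) : PrimrecPred fun a => p → q a := by
  by_cases hp : p
  · exact hq.of_eq fun a => by simp [hp]
  · exact (PrimrecPred.not hq).or hq |>.of_eq fun a => by simp [hp, em']

theorem primrecRel_mem {α : Type*} [Primcodable α] [DecidableEq α] :
    PrimrecRel fun (a : α) (l : List α) => a ∈ l :=
  ((Primrec.eq (α := α)).exists_mem_list.comp Primrec.snd Primrec.fst).of_eq fun x => by simp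

theorem primrecRel_admitsCode (U : UpdateClass) : PrimrecRel U.AdmitsCode := by
  refine PrimrecPred.and (primrecPred_imp (primrecPred_nodup.comp Primrec.snd))
    (PrimrecPred.and (primrecPred_imp ?_) (primrecPred_imp ?_))
  · have h : PrimrecRel fun (i : ℕ) (l : List ℕ) => i ∈ l := primrecRel_mem
    exact (primrecRel_forall_lt h).comp Primrec.fst Primrec.snd
  · exact Primrec.eq.comp Primrec.snd (Primrec.list_range.comp Primrec.fst)

/-- The codes of the pairs of terms, at least one of which is a variable, that coincide
on the tuple coded by `d`. -/
def pairCodes (d : List ℕ) : List (ℕ × ℕ) :=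
  (List.range d.length).flatMap fun i =>
    (preimageCodes d (d[i]?.getD 0)).flatMap fun t => [(varCode i, t), (t, varCode i)]

theorem primrec_pairCodes : Primrec pairCodes := by
  have h1 : Primrec₂ fun (x : List ℕ × ℕ) (t : ℕ) => [(varCode x.2, t), (t, varCode x.2)] := by
    have hv : Primrec fun y : (List ℕ × ℕ) × ℕ => varCode y.1.2 :=
      primrec_varCode.comp (Primrec.snd.comp Primrec.fst)
    exact Primrec.list_cons.comp (hv.pair Primrec.snd)
      (Primrec.list_cons.comp (Primrec.snd.pair hv) (Primrec.const []))
  have h2 : Primrec₂ fun (d : List ℕ) (i : ℕ) =>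
      (preimageCodes d (d[i]?.getD 0)).flatMap fun t => [(varCode i, t), (t, varCode i)] :=
    Primrec.list_flatMap (primrec_preimageCodes.comp Primrec.fst
      (Primrec.option_getD.comp Primrec.list_getElem? (Primrec.const 0))) h1
  exact Primrec.list_flatMap (Primrec.list_range.comp Primrec.list_length) h2

/-- Codes of equations that hold on the tuple coded by `d`: up to equivalence, all of them. -/
def equationCodes (U : UpdateClass) (d : List ℕ) : List (List ℕ × List ℕ) :=
  -- Repeated pairs can be dropped, so the number of available pairs bounds the length. Lists are
  -- used rather than sets because linearity depends on the order of the pairs.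
  ((boundedLists (pairCodes d) (pairCodes d).length).map fun L =>
      (L.map Prod.fst, L.map Prod.snd)).filter fun e =>
    U.AdmitsCode d.length (e.1.flatMap varsCode) ∧ U.AdmitsCode d.length (e.2.flatMap varsCode)

theorem primrec_equationCodes (U : UpdateClass) : Primrec (equationCodes U) := by
  have h1 : Primrec₂ fun (_ : List ℕ) (L : List (ℕ × ℕ)) => (L.map Prod.fst, L.map Prod.snd) :=
    (Primrec.list_map Primrec.snd (Primrec.fst.comp Primrec.snd).to₂).pair
      (Primrec.list_map Primrec.snd (Primrec.snd.comp Primrec.snd).to₂)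
  have hv : Primrec fun l : List ℕ => l.flatMap varsCode :=
    Primrec.list_flatMap Primrec.id (primrec_varsCode.comp Primrec.snd)
  refine primrec_filter (Primrec.list_map
    (primrec_boundedLists.comp primrec_pairCodes (Primrec.list_length.comp primrec_pairCodes)) h1)
    (p := fun d (e : List ℕ × List ℕ) => U.AdmitsCode d.length (e.1.flatMap varsCode) ∧
      U.AdmitsCode d.length (e.2.flatMap varsCode)) (PrimrecPred.and ?_ ?_)
  · exact (primrecRel_admitsCode U).comp (Primrec.list_length.comp Primrec.fst)
      (hv.comp (Primrec.fst.comp Primrec.snd))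
  · exact (primrecRel_admitsCode U).comp (Primrec.list_length.comp Primrec.fst)
      (hv.comp (Primrec.snd.comp Primrec.snd))

/-- `Equation.Holds`, on codes. -/
abbrev HoldsCode (e : List ℕ × List ℕ) (d : List ℕ) : Prop :=
  e.1.map (substCode d) = e.2.map (substCode d)

theorem primrecRel_holdsCode : PrimrecRel HoldsCode := by
  refine Primrec.eq.comp (Primrec.list_map (Primrec.fst.comp Primrec.fst) ?_)
    (Primrec.list_map (Primrec.snd.comp Primrec.fst) ?_) <;>
  exact primrec_substCode.comp (Primrec.snd.comp Primrec.fst) Primrec.snd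

/-- `Transf.apply`, on codes. -/
def applyCode (f : TransfCode) (x : ℕ × List ℕ) : Option (ℕ × List ℕ) :=
  (f[x.1]?.getD none).map fun m => (m.1, m.2.map (substCode x.2))

theorem primrec_applyCode : Primrec₂ applyCode := by
  refine Primrec.option_map (Primrec.option_getD.comp (Primrec.list_getElem?.comp Primrec.fst
    (Primrec.fst.comp Primrec.snd)) (Primrec.const none)) ?_
  have h : Primrec₂ fun (y : (TransfCode × ℕ × List ℕ) × ℕ × List ℕ) (t : ℕ) =>
      substCode y.1.2.2 t :=
    primrec_substCode.comp (Primrec.snd.comp (Primrec.snd.comp (Primrec.fst.comp Primrec.fst)))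
      Primrec.snd
  exact (Primrec.fst.comp Primrec.snd).pair (Primrec.list_map (Primrec.snd.comp Primrec.snd) h)

/-- The codes of the configurations reached on the words of length at most `n`. -/
def reachCodes (B : TransducerCode) (n : ℕ) : List (ℕ × List ℕ) :=
  (fun R => R ++ R.flatMap fun x => B.2.2.2.1.filterMap fun f => applyCode f x)^[n]
    (applyCode B.2.2.1 (0, [])).toList

theorem primrec_reachCodes : Primrec₂ reachCodes := by
  have h1 : Primrec₂ fun (y : ((TransducerCode × ℕ) × List (ℕ × List ℕ)) × ℕ × List ℕ)
      (f : TransfCode) => applyCode f y.2 :=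
    primrec_applyCode.comp Primrec.snd (Primrec.snd.comp Primrec.fst)
  have h2 : Primrec₂ fun (y : (TransducerCode × ℕ) × List (ℕ × List ℕ)) (x : ℕ × List ℕ) =>
      y.1.1.2.2.2.1.filterMap fun f => applyCode f x :=
    Primrec.listFilterMap (Primrec.fst.comp (Primrec.snd.comp (Primrec.snd.comp
      (Primrec.snd.comp (Primrec.fst.comp (Primrec.fst.comp Primrec.fst)))))) h1
  have h3 : Primrec₂ fun (y : TransducerCode × ℕ) (R : List (ℕ × List ℕ)) =>
      R ++ R.flatMap fun x => y.1.2.2.2.1.filterMap fun f => applyCode f x :=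
    Primrec.list_append.comp Primrec.snd (Primrec.list_flatMap Primrec.snd h2)
  exact Primrec.nat_iterate Primrec.snd (Primrec.optionToList.comp (primrec_applyCode.comp
    (Primrec.fst.comp (Primrec.snd.comp (Primrec.snd.comp Primrec.fst))) (Primrec.const _))) h3

/-- A pool of equations that suffices to define the closures at all reached states. -/
def poolCodes (U : UpdateClass) (B : TransducerCode) : List (ℕ × List ℕ × List ℕ) :=
  -- Words no longer than the number of states reach every reachable state, and one datum per state
  -- is enough.
  (reachCodes B B.2.1.length).flatMap fun x => (equationCodes U x.2).map fun e => (x.1, e)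

theorem primrec_poolCodes (U : UpdateClass) : Primrec (poolCodes U) := by
  have h1 : Primrec₂ fun (y : TransducerCode × ℕ × List ℕ) (e : List ℕ × List ℕ) => (y.2.1, e) :=
    (Primrec.fst.comp (Primrec.snd.comp Primrec.fst)).pair Primrec.snd
  have h2 : Primrec₂ fun (_ : TransducerCode) (x : ℕ × List ℕ) =>
      (equationCodes U x.2).map fun e => (x.1, e) :=
    Primrec.list_map ((primrec_equationCodes U).comp (Primrec.snd.comp Primrec.snd)) h1
  exact Primrec.list_flatMap (primrec_reachCodes.comp Primrec.id
    (Primrec.list_length.comp (Primrec.fst.comp Primrec.snd))) h2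

/-- The codes of enough reachable configurations to determine the closures. -/
def witnessCodes (U : UpdateClass) (B : TransducerCode) : List (ℕ × List ℕ) :=
  -- The first summand makes all reachable states appear; after that, every change of the closure
  -- refutes a further equation of the pool.
  reachCodes B (B.2.1.length + (poolCodes U B).length)

theorem primrec_witnessCodes (U : UpdateClass) : Primrec (witnessCodes U) :=
  primrec_reachCodes.comp Primrec.id (Primrec.nat_add.comp
    (Primrec.list_length.comp (Primrec.fst.comp Primrec.snd))
    (Primrec.list_length.comp (primrec_poolCodes U)))

/-- The codes of the equations that define the closure at the state `q`. -/
def domainCodes (U : UpdateClass) (B : TransducerCode) (q : ℕ) : List (List ℕ × List ℕ) :=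
  ((poolCodes U B).filter fun p =>
    p.1 = q ∧ ∀ x ∈ witnessCodes U B, ¬ x.1 = q ∨ HoldsCode p.2 x.2).map Prod.snd

theorem primrec_domainCodes (U : UpdateClass) : Primrec₂ (domainCodes U) := by
  have h1 : PrimrecRel fun (x : ℕ × List ℕ) (y : ℕ × List ℕ × List ℕ) =>
      ¬ x.1 = y.1 ∨ HoldsCode y.2 x.2 :=
    PrimrecPred.or (PrimrecPred.not (Primrec.eq.comp (Primrec.fst.comp Primrec.fst)
      (Primrec.fst.comp Primrec.snd))) (primrecRel_holdsCode.comp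
      (Primrec.snd.comp Primrec.snd) (Primrec.snd.comp Primrec.fst))
  have h2 : PrimrecRel fun (b : TransducerCode × ℕ) (p : ℕ × List ℕ × List ℕ) =>
      p.1 = b.2 ∧ ∀ x ∈ witnessCodes U b.1, ¬ x.1 = b.2 ∨ HoldsCode p.2 x.2 := by
    refine PrimrecPred.and (Primrec.eq.comp (Primrec.fst.comp Primrec.snd)
      (Primrec.snd.comp Primrec.fst)) ?_
    exact h1.forall_mem_list.comp ((primrec_witnessCodes U).comp (Primrec.fst.comp Primrec.fst))
      ((Primrec.snd.comp Primrec.fst).pair (Primrec.snd.comp Primrec.snd))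
  exact Primrec.list_map (primrec_filter ((primrec_poolCodes U).comp Primrec.fst) h2)
    (Primrec.snd.comp Primrec.snd)

/-- The reached control states. -/
def stateCodes (U : UpdateClass) (B : TransducerCode) : List ℕ :=
  (List.range B.2.1.length).filter fun q => ∃ x ∈ witnessCodes U B, x.1 = q

theorem primrec_stateCodes (U : UpdateClass) : Primrec (stateCodes U) := by
  have h1 : PrimrecRel fun (x : ℕ × List ℕ) (q : ℕ) => x.1 = q :=
    Primrec.eq.comp (Primrec.fst.comp Primrec.fst) Primrec.snd
  have h2 : PrimrecRel fun (B : TransducerCode) (q : ℕ) => ∃ x ∈ witnessCodes U B, x.1 = q :=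
    h1.exists_mem_list.comp ((primrec_witnessCodes U).comp Primrec.fst) Primrec.snd
  exact primrec_filter (Primrec.list_range.comp
    (Primrec.list_length.comp (Primrec.fst.comp Primrec.snd))) h2

/-- The code of a transition, with its target state replaced by its index in `L`. -/
def relabelCode (L : List ℕ) (m : Option (ℕ × List ℕ)) : Option (ℕ × List ℕ) :=
  m.map fun m => (L.idxOf m.1, m.2)

theorem primrec_relabelCode : Primrec₂ relabelCode :=
  Primrec.option_map Primrec.snd ((Primrec.list_idxOf.comp (Primrec.fst.comp Primrec.snd)
    (Primrec.fst.comp Primrec.fst)).pair (Primrec.snd.comp Primrec.snd))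

/-- The code of the initial image, from the code of a finite transducer. -/
def imageCode (U : UpdateClass) (B : TransducerCode) : TransducerCode :=
  (B.1,
    (stateCodes U B).map fun q => ((B.2.1[q]?.getD (0, [])).1, domainCodes U B q),
    B.2.2.1.map (relabelCode (stateCodes U B)),
    B.2.2.2.1.map fun f => (stateCodes U B).map fun q =>
      relabelCode (stateCodes U B) (f[q]?.getD none),
    -- The final transformation is restricted but not relabelled, because its target space does not
    -- change; the initial one above is relabelled but not restricted.
    (stateCodes U B).map fun q => B.2.2.2.2[q]?.getD none)

theorem primrec_imageCode (U : UpdateClass) : Primrec (imageCode U) := by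
  have hL := primrec_stateCodes U
  have h1 : Primrec₂ fun (B : TransducerCode) (q : ℕ) =>
      ((B.2.1[q]?.getD (0, [])).1, domainCodes U B q) :=
    (Primrec.fst.comp (Primrec.option_getD.comp (Primrec.list_getElem?.comp
      (Primrec.fst.comp (Primrec.snd.comp Primrec.fst)) Primrec.snd) (Primrec.const _))).pair
      (primrec_domainCodes U)
  have h2 : Primrec₂ fun (x : TransducerCode × TransfCode) (q : ℕ) =>
      relabelCode (stateCodes U x.1) (x.2[q]?.getD none) :=
    primrec_relabelCode.comp (hL.comp (Primrec.fst.comp Primrec.fst))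
      (Primrec.option_getD.comp (Primrec.list_getElem?.comp (Primrec.snd.comp Primrec.fst)
        Primrec.snd) (Primrec.const none))
  have h3 : Primrec₂ fun (B : TransducerCode) (f : TransfCode) =>
      (stateCodes U B).map fun q => relabelCode (stateCodes U B) (f[q]?.getD none) :=
    Primrec.list_map (hL.comp Primrec.fst) h2
  have h4 : Primrec₂ fun (B : TransducerCode) (q : ℕ) => B.2.2.2.2[q]?.getD none :=
    Primrec.option_getD.comp (Primrec.list_getElem?.comp (Primrec.snd.comp (Primrec.snd.comp
      (Primrec.snd.comp (Primrec.snd.comp Primrec.fst)))) Primrec.snd) (Primrec.const none)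
  have h5 : Primrec₂ fun (B : TransducerCode) (m : Option (ℕ × List ℕ)) =>
      relabelCode (stateCodes U B) m :=
    primrec_relabelCode.comp (hL.comp Primrec.fst) Primrec.snd
  have h22 : Primrec fun B : TransducerCode => B.2.2 := Primrec.snd.comp Primrec.snd
  exact Primrec.fst.pair ((Primrec.list_map hL h1).pair
    ((Primrec.list_map (Primrec.fst.comp h22) h5).pair
    ((Primrec.list_map (Primrec.fst.comp (Primrec.snd.comp h22)) h3).pair
    (Primrec.list_map hL h4))))

/-! ### Correctness of the operations on codes of terms -/

section
variable {Γ : RankedAlphabet} {n m k : ℕ}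

theorem Term.code_var (i : Fin n) : (Term.var i : Term Γ n).code = varCode i := by
  rw [Term.code]; rfl

theorem Term.code_app (f : Fin Γ.size) (args : Fin (Γ.arity f) → Term Γ n) :
    (Term.app f args).code = appCode f (List.ofFn fun j => (args j).code) := by
  rw [Term.code]; rfl

theorem varCode_injective : Function.Injective varCode := fun i j h => by
  simpa [varCode] using h

theorem varCode_ne_appCode (i f : ℕ) (l : List ℕ) : varCode i ≠ appCode f l := by
  intro h
  have h' := Encodable.encode_injective h
  cases h'

theorem appCode_inj {f g : ℕ} {l l' : List ℕ} : appCode f l = appCode g l' ↔ f = g ∧ l = l' := by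
  constructor
  · intro h
    have h' := Encodable.encode_injective h
    simpa using h'
  · rintro ⟨rfl, rfl⟩; rfl

theorem Term.code_injective : Function.Injective (Term.code : Term Γ n → ℕ) := by
  intro s
  induction s with
  | var i =>
    rintro (j | ⟨g, args⟩) h
    · rw [Term.code_var, Term.code_var] at h
      rw [Fin.ext (varCode_injective h)]
    · rw [Term.code_var, Term.code_app] at h
      exact absurd h (varCode_ne_appCode _ _ _)
  | app f args ih =>
    rintro (j | ⟨g, args'⟩) h
    · rw [Term.code_var, Term.code_app] at h
      exact absurd h.symm (varCode_ne_appCode _ _ _)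
    · rw [Term.code_app, Term.code_app, appCode_inj] at h
      obtain ⟨hf, hl⟩ := h
      obtain rfl := Fin.ext hf
      have h' := List.ofFn_injective hl
      exact congrArg _ (funext fun j => ih j (congrFun h' j))

/-- The list of codes of a tuple of terms. -/
abbrev tupleCode (d : Fin k → Term Γ n) : List ℕ := List.ofFn fun i => (d i).code

theorem tupleCode_injective : Function.Injective (tupleCode : (Fin k → Term Γ n) → List ℕ) :=
  fun _ _ h => funext fun i => Term.code_injective (congrFun (List.ofFn_injective h) i)

theorem tupleCode_getElem? (d : Fin k → Term Γ n) (i : Fin k) :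
    (tupleCode d)[i.1]? = some (d i).code := by
  simp [tupleCode]

theorem substCode_code (d : Fin n → Term Γ m) (t : Term Γ n) :
    substCode (tupleCode d) t.code = (t.subst d).code := by
  induction t with
  | var i =>
    rw [Term.code_var, substCode, codeRec_varCode, tupleCode_getElem?]
    rfl
  | app f args ih =>
    rw [Term.code_app, substCode, codeRec_appCode, ← substCode, Term.subst, Term.code_app]
    simp only [List.map_ofFn, Function.comp_def, ih]

theorem map_substCode_tupleCode (d : Fin n → Term Γ m) (u : Fin k → Term Γ n) :
    (tupleCode u).map (substCode (tupleCode d)) = tupleCode fun j => (u j).subst d := by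
  simp only [tupleCode, List.map_ofFn, Function.comp_def]
  exact congrArg _ (funext fun j => substCode_code d (u j))

theorem varsCode_code (t : Term Γ n) : varsCode t.code = t.vars.map Fin.val := by
  induction t with
  | var i => rw [Term.code_var, varsCode, codeRec_varCode]; simp [Term.vars]
  | app f args ih =>
    rw [Term.code_app, varsCode, codeRec_appCode, ← varsCode, Term.vars]
    simp only [List.map_ofFn, Function.comp_def, ih, List.map_flatten]

theorem exists_map_eq {α β : Type*} {f : α → β} {l : List β} (h : ∀ x ∈ l, ∃ a, f a = x) :
    ∃ l' : List α, l'.map f = l := by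
  induction l with
  | nil => exact ⟨[], rfl⟩
  | cons x l ih =>
    obtain ⟨a, rfl⟩ := h x (by simp)
    obtain ⟨l', rfl⟩ := ih fun y hy => h y (by simp [hy])
    exact ⟨a :: l', rfl⟩

theorem forall₂_ofFn_right {α β : Type*} {R : α → β → Prop} {l : List α} {g : Fin k → β} :
    List.Forall₂ R l (List.ofFn g) ↔ ∃ f : Fin k → α, l = List.ofFn f ∧ ∀ i, R (f i) (g i) := by
  rw [List.forall₂_iff_get]
  constructor
  · rintro ⟨h, h'⟩
    have hk : l.length = k := by simpa using h
    subst hk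
    refine ⟨l.get, by simp, fun i => ?_⟩
    simpa using h' i i.2 (by simp)
  · rintro ⟨f, rfl, h⟩
    refine ⟨by simp, fun i h1 h2 => ?_⟩
    simpa using h ⟨i, by simpa using h1⟩

/-- By induction on `g`. The ground arguments of `g` are fixed in advance, so a preimage either
stops at a variable or continues below the same root symbol; this is why there are only finitely
many. -/
theorem mem_preimageCodes {d : Data Γ n} {g : GroundTerm Γ} {x : ℕ} :
    x ∈ preimageCodes (tupleCode d) g.code ↔ ∃ t : Term Γ n, t.code = x ∧ t.subst d = g := by
  induction g generalizing x with
  | var i => exact i.elim0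
  | app f args ih =>
    rw [Term.code_app, preimageCodes, codeRec_appCode]
    simp only [List.mem_append, List.mem_map, List.mem_filter, List.mem_range,
      decide_eq_true_eq, List.mem_sections]
    rw [List.map_ofFn]
    simp only [forall₂_ofFn_right]
    constructor
    · rintro (⟨i, ⟨hi, hdi⟩, rfl⟩ | ⟨l, ⟨c, rfl, hc⟩, rfl⟩)
      · have hi' : i < n := by simpa using hi
        refine ⟨.var ⟨i, hi'⟩, Term.code_var _, Term.code_injective ?_⟩
        have h1 := tupleCode_getElem? d ⟨i, hi'⟩
        rw [h1] at hdi
        rw [Term.subst, Option.some.inj hdi, Term.code_app]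
      · choose t ht ht' using fun j => (ih j).1 (hc j)
        refine ⟨.app f t, ?_, ?_⟩
        · rw [Term.code_app]; simp only [ht]
        · rw [Term.subst]; simp only [ht']
    · rintro ⟨t, rfl, ht⟩
      rcases t with i | ⟨f', args'⟩
      · refine Or.inl ⟨i, ⟨by simp, ?_⟩, (Term.code_var i).symm⟩
        rw [Term.subst] at ht
        rw [tupleCode_getElem?, ht, Term.code_app]
      · rw [Term.subst] at ht
        injection ht with h1 h2
        subst h1
        refine Or.inr ⟨_, ⟨fun j => (args' j).code, rfl, fun j => ?_⟩, (Term.code_app _ _).symm⟩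
        exact (ih j).2 ⟨args' j, rfl, congrFun (eq_of_heq h2) j⟩

/-! ### Equations that hold on a given tuple -/

def Term.IsVar : Term Γ n → Prop
  | .var _ => True
  | .app _ _ => False

theorem mem_pairCodes {d : Data Γ n} {p : ℕ × ℕ} : p ∈ pairCodes (tupleCode d) ↔
    ∃ s t : Term Γ n, (s.code, t.code) = p ∧ s.subst d = t.subst d ∧ (s.IsVar ∨ t.IsVar) := by
  simp only [pairCodes, List.mem_flatMap, List.mem_range, List.mem_cons, List.not_mem_nil, or_false]
  constructor
  · rintro ⟨i, hi, x, hx, hp⟩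
    have hi' : i < n := by simpa using hi
    have h1 := tupleCode_getElem? d ⟨i, hi'⟩
    rw [h1] at hx
    obtain ⟨t, rfl, ht⟩ := mem_preimageCodes.1 hx
    rcases hp with rfl | rfl
    · exact ⟨.var ⟨i, hi'⟩, t, by rw [Term.code_var], by rw [Term.subst, ht], Or.inl trivial⟩
    · exact ⟨t, .var ⟨i, hi'⟩, by rw [Term.code_var], by rw [Term.subst, ht], Or.inr trivial⟩
  · rintro ⟨s, t, rfl, hst, h⟩
    rcases h with h | h
    · rcases s with i | _
      · refine ⟨i, by simp, t.code, ?_, Or.inl (by rw [Term.code_var])⟩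
        rw [tupleCode_getElem?]
        exact mem_preimageCodes.2 ⟨t, rfl, by rw [← hst, Term.subst]⟩
      · exact h.elim
    · rcases t with i | _
      · refine ⟨i, by simp, s.code, ?_, Or.inr (by rw [Term.code_var])⟩
        rw [tupleCode_getElem?]
        exact mem_preimageCodes.2 ⟨s, rfl, by rw [hst, Term.subst]⟩
      · exact h.elim

/-- The decomposition of an equation between two terms that coincide on `d`. -/
theorem exists_decomposition (d : Data Γ n) (s : Term Γ n) : ∀ t : Term Γ n,
    s.subst d = t.subst d → ∃ L : List (Term Γ n × Term Γ n),
      (L.map Prod.fst).flatMap Term.vars = s.vars ∧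
      (L.map Prod.snd).flatMap Term.vars = t.vars ∧
      (∀ p ∈ L, p.1.subst d = p.2.subst d ∧ (p.1.IsVar ∨ p.2.IsVar)) ∧
      ∀ d' : Data Γ n, (∀ p ∈ L, p.1.subst d' = p.2.subst d') ↔ s.subst d' = t.subst d' := by
  induction s with
  | var i =>
    intro t h
    exact ⟨[(.var i, t)], by simp, by simp, by simpa [Term.IsVar] using h, by simp⟩
  | app f args ih =>
    rintro (i | ⟨g, args'⟩) h
    · exact ⟨[(.app f args, .var i)], by simp, by simp, by simpa [Term.IsVar] using h, by simp⟩
    -- Two applications that coincide on `d` have the same root symbol. Concatenating the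
    -- decompositions of the arguments in order preserves the left-to-right sequence of variables on
    -- each side, which is what the restrictions on updates depend on.
    · rw [Term.subst, Term.subst] at h
      injection h with h1 h2
      subst h1
      choose L h1 h2 h3 h4 using fun j => ih j (args' j) (congrFun (eq_of_heq h2) j)
      refine ⟨(List.ofFn L).flatten, ?_, ?_, ?_, fun d' => ?_⟩
      · rw [Term.vars, List.map_flatten, List.flatMap_def, List.map_flatten, List.flatten_flatten]
        simp only [List.map_ofFn, Function.comp_def, ← h1, List.flatMap_def]
      · rw [Term.vars, List.map_flatten, List.flatMap_def, List.map_flatten, List.flatten_flatten]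
        simp only [List.map_ofFn, Function.comp_def, ← h2, List.flatMap_def]
      · intro p hp
        simp only [List.mem_flatten, List.mem_ofFn] at hp
        obtain ⟨_, ⟨j, rfl⟩, hp⟩ := hp
        exact h3 j p hp
      · rw [Term.subst, Term.subst]
        constructor
        · intro h
          refine congrArg _ (funext fun j => (h4 j d').1 fun p hp => h p ?_)
          simp only [List.mem_flatten, List.mem_ofFn]
          exact ⟨_, ⟨j, rfl⟩, hp⟩
        · intro h p hp
          injection h with _ h
          simp only [List.mem_flatten, List.mem_ofFn] at hp
          obtain ⟨_, ⟨j, rfl⟩, hp⟩ := hp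
          exact (h4 j d').2 (congrFun h j) p hp

end

section
variable {Γ : RankedAlphabet} {U : UpdateClass} {n m k : ℕ}

theorem UpdateClass.admitsCode_map_val {l : List (Fin n)} :
    U.AdmitsCode n (l.map Fin.val) ↔ U.Admits l := by
  refine and_congr (imp_congr_right fun _ => ?_) (and_congr (imp_congr_right fun _ => ?_)
    (imp_congr_right fun _ => ?_))
  · exact List.nodup_map_iff Fin.val_injective
  · constructor
    · intro h i
      obtain ⟨j, hj, hji⟩ := List.mem_map.1 (h i i.2)
      exact Fin.ext hji ▸ hj
    · exact fun h i hi => List.mem_map.2 ⟨⟨i, hi⟩, h _, rfl⟩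
  · rw [← List.map_coe_finRange_eq_range, (List.map_injective_iff.2 Fin.val_injective).eq_iff]

/-- The equation that consists of the equations in a list of pairs of terms. -/
def Equation.ofPairs (L : List (Term Γ n × Term Γ n))
    (h₁ : U.Admits ((L.map Prod.fst).flatMap Term.vars))
    (h₂ : U.Admits ((L.map Prod.snd).flatMap Term.vars)) : Equation Γ U n where
  width := L.length
  lhs := ⟨fun j => L[j].1, by
    convert h₁ using 1
    rw [List.flatMap_def, List.map_map, ← List.ofFn_getElem_eq_map]; rfl⟩
  rhs := ⟨fun j => L[j].2, by
    convert h₂ using 1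
    rw [List.flatMap_def, List.map_map, ← List.ofFn_getElem_eq_map]; rfl⟩

theorem Equation.ofPairs_code (L : List (Term Γ n × Term Γ n))
    (h₁ : U.Admits ((L.map Prod.fst).flatMap Term.vars))
    (h₂ : U.Admits ((L.map Prod.snd).flatMap Term.vars)) :
    (Equation.ofPairs L h₁ h₂).code =
      ((L.map fun p => p.1.code), (L.map fun p => p.2.code)) := by
  rw [← List.ofFn_getElem_eq_map, ← List.ofFn_getElem_eq_map]; rfl

theorem Equation.ofPairs_holds {L : List (Term Γ n × Term Γ n)}
    {h₁ : U.Admits ((L.map Prod.fst).flatMap Term.vars)}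
    {h₂ : U.Admits ((L.map Prod.snd).flatMap Term.vars)} {d : Data Γ n} :
    (Equation.ofPairs L h₁ h₂).Holds d ↔ ∀ p ∈ L, p.1.subst d = p.2.subst d := by
  constructor
  · intro h p hp
    obtain ⟨j, hj, rfl⟩ := List.mem_iff_getElem.1 hp
    exact congrFun h ⟨j, hj⟩
  · intro h
    exact funext fun j => h _ (List.getElem_mem j.2)

theorem holdsCode_code {e : Equation Γ U n} {d : Data Γ n} :
    HoldsCode e.code (tupleCode d) ↔ e.Holds d := by
  rw [Equation.Holds, ← tupleCode_injective.eq_iff]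
  exact Eq.congr (map_substCode_tupleCode d e.lhs.terms) (map_substCode_tupleCode d e.rhs.terms)

/-- Ensures that the computed lists contain only codes of equations between legitimate updates, so
that the output of the algorithm is the code of an actual transducer. -/
theorem exists_equation_of_mem_equationCodes {d : Data Γ n} {p : List ℕ × List ℕ}
    (hp : p ∈ equationCodes U (tupleCode d)) : ∃ e : Equation Γ U n, e.code = p := by
  simp only [equationCodes, List.mem_filter, List.mem_map, mem_boundedLists,
    decide_eq_true_eq] at hp
  obtain ⟨⟨L, ⟨_, hL⟩, rfl⟩, h₁, h₂⟩ := hp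
  obtain ⟨L, rfl⟩ := exists_map_eq (f := fun p : Term Γ n × Term Γ n => (p.1.code, p.2.code))
    fun x hx => by
      obtain ⟨s, t, h, _⟩ := mem_pairCodes.1 (hL x hx)
      exact ⟨(s, t), h⟩
  simp only [List.map_map, List.flatMap_map, Function.comp_def, varsCode_code,
    List.length_ofFn] at h₁ h₂
  rw [← List.map_flatMap, UpdateClass.admitsCode_map_val] at h₁ h₂
  refine ⟨.ofPairs L (by rwa [List.flatMap_map]) (by rwa [List.flatMap_map]), ?_⟩
  rw [Equation.ofPairs_code]
  simp [Function.comp_def]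

theorem Term.IsVar.vars_ne_nil {t : Term Γ n} (h : t.IsVar) : t.vars ≠ [] := by
  rcases t with i | _
  · simp [Term.vars]
  · exact h.elim

/-- A repeated pair would repeat, on one of the two sides, the variable that it contains. -/
theorem nodup_of_nodup_vars {L : List (Term Γ n × Term Γ n)}
    (h₁ : ((L.map Prod.fst).flatMap Term.vars).Nodup)
    (h₂ : ((L.map Prod.snd).flatMap Term.vars).Nodup)
    (hL : ∀ p ∈ L, p.1.IsVar ∨ p.2.IsVar) : L.Nodup := by
  rw [List.flatMap_map, List.nodup_flatMap] at h₁ h₂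
  refine (h₁.2.and h₂.2).imp_of_mem ?_
  rintro p q hp _ ⟨h, h'⟩ rfl
  rcases hL p hp with hv | hv
  · exact hv.vars_ne_nil (List.eq_nil_iff_forall_not_mem.2 fun _ hx => h hx hx)
  · exact hv.vars_ne_nil (List.eq_nil_iff_forall_not_mem.2 fun _ hx => h' hx hx)

/-- Every equation that holds on `d` is equivalent to one in the list computed from `d`. -/
theorem exists_mem_equationCodes {d : Data Γ n} {e : Equation Γ U n} (he : e.Holds d) :
    ∃ e' : Equation Γ U n, e'.code ∈ equationCodes U (tupleCode d) ∧
      ∀ d', e'.Holds d' ↔ e.Holds d' := by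
  classical
  obtain ⟨w, l, r⟩ := e
  choose L h1 h2 h3 h4 using fun j =>
    exists_decomposition d (l.terms j) (r.terms j) (congrFun he j)
  set L' := (List.ofFn L).flatten with hL'
  have hmem : ∀ p, p ∈ L' ↔ ∃ j, p ∈ L j := by
    intro p
    simp [hL', List.mem_flatten, List.mem_ofFn]
  have hl : U.Admits ((L'.map Prod.fst).flatMap Term.vars) := by
    convert l.admits using 1
    rw [hL', List.map_flatten, List.flatMap_def, List.map_flatten, List.flatten_flatten]
    simp only [List.map_ofFn, Function.comp_def, ← h1, List.flatMap_def]
  have hr : U.Admits ((L'.map Prod.snd).flatMap Term.vars) := by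
    convert r.admits using 1
    rw [hL', List.map_flatten, List.flatMap_def, List.map_flatten, List.flatten_flatten]
    simp only [List.map_ofFn, Function.comp_def, ← h2, List.flatMap_def]
  have hvar : ∀ p ∈ L', p.1.subst d = p.2.subst d ∧ (p.1.IsVar ∨ p.2.IsVar) := fun p hp => by
    obtain ⟨j, hj⟩ := (hmem p).1 hp
    exact h3 j p hj
  have hdedup : U.Admits ((L'.dedup.map Prod.fst).flatMap Term.vars) ∧
      -- Deduplication is needed for the length bound and has to respect the restrictions. If both
      -- variable sequences are free of repetitions, then so is `L'` and nothing is removed.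
      -- Otherwise the class is neither copyless nor linear, and non-erasure depends only on the set
      -- of variables.
      U.Admits ((L'.dedup.map Prod.snd).flatMap Term.vars) := by
    by_cases hc : ((L'.map Prod.fst).flatMap Term.vars).Nodup ∧
        ((L'.map Prod.snd).flatMap Term.vars).Nodup
    · rw [(nodup_of_nodup_vars hc.1 hc.2 fun p hp => (hvar p hp).2).dedup]
      exact ⟨hl, hr⟩
    · have hU : U.copyless ≠ true ∧ U.linear ≠ true :=
        ⟨fun h => hc ⟨hl.1 h, hr.1 h⟩, fun h => hc
          ⟨hl.2.2 h ▸ List.nodup_finRange n, hr.2.2 h ▸ List.nodup_finRange n⟩⟩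
      refine ⟨⟨fun h => absurd h hU.1, fun h i => ?_, fun h => absurd h hU.2⟩,
        ⟨fun h => absurd h hU.1, fun h i => ?_, fun h => absurd h hU.2⟩⟩
      · simpa using hl.2.1 h i
      · simpa using hr.2.1 h i
  refine ⟨.ofPairs L'.dedup hdedup.1 hdedup.2, ?_, fun d' => ?_⟩
  · rw [Equation.ofPairs_code]
    simp only [equationCodes, List.mem_filter, List.mem_map, mem_boundedLists,
      decide_eq_true_eq]
    refine ⟨⟨L'.dedup.map fun p => (p.1.code, p.2.code), ⟨?_, ?_⟩, ?_⟩, ?_⟩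
    -- The codes of distinct pairs are distinct elements of `pairCodes`, hence no more numerous than
    -- its length.
    · refine (List.Nodup.subperm ((L'.nodup_dedup).map ?_) ?_).length_le
      · rintro ⟨s, t⟩ ⟨s', t'⟩ h
        simp only [Prod.mk.injEq] at h
        rw [Term.code_injective h.1, Term.code_injective h.2]
      · intro x hx
        obtain ⟨p, hp, rfl⟩ := List.mem_map.1 hx
        exact mem_pairCodes.2 ⟨p.1, p.2, rfl, hvar p (List.mem_dedup.1 hp)⟩
    · intro x hx
      obtain ⟨p, hp, rfl⟩ := List.mem_map.1 hx
      exact mem_pairCodes.2 ⟨p.1, p.2, rfl, hvar p (List.mem_dedup.1 hp)⟩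
    · simp [Function.comp_def]
    · simp only [List.flatMap_map, varsCode_code, List.length_ofFn]
      rw [← List.map_flatMap, ← List.map_flatMap, UpdateClass.admitsCode_map_val,
        UpdateClass.admitsCode_map_val]
      simpa only [List.flatMap_map] using hdedup
  · rw [Equation.ofPairs_holds]
    constructor
    · intro h
      exact funext fun j => (h4 j d').1 fun p hp => h p (List.mem_dedup.2 ((hmem p).2 ⟨j, hp⟩))
    · intro h p hp
      obtain ⟨j, hj⟩ := (hmem p).1 (List.mem_dedup.1 hp)
      exact (h4 j d').2 (congrFun h j) p hj

/-! ### Composition of updates, and closures -/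

theorem Term.subst_var (t : Term Γ n) : t.subst Term.var = t := by
  induction t with
  | var i => rfl
  | app f args ih => rw [Term.subst]; simp only [ih]

theorem Term.subst_eq_self (t : GroundTerm Γ) (d : Data Γ 0) : t.subst d = t := by
  rw [show d = Term.var from funext fun i => i.elim0, Term.subst_var]

theorem Term.subst_subst (t : Term Γ n) (u : Fin n → Term Γ m) (v : Fin m → Term Γ k) :
    (t.subst u).subst v = t.subst fun i => (u i).subst v := by
  induction t with
  | var i => rfl
  | app f args ih => simp only [Term.subst, ih]

theorem Term.vars_subst (t : Term Γ n) (u : Fin n → Term Γ m) :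
    (t.subst u).vars = t.vars.flatMap fun i => (u i).vars := by
  induction t with
  | var i => simp [Term.subst, Term.vars]
  | app f args ih =>
    simp only [Term.subst, Term.vars, ih]
    simp only [List.flatMap_def, List.map_flatten, List.flatten_flatten, List.map_ofFn,
      Function.comp_def]

/-- Each restriction survives substitution, so updates of a fixed class compose. For copylessness,
distinct variables are replaced by terms with disjoint variables; for linearity, `l` lists all
variables in order, so the result is the full concatenation. -/
theorem UpdateClass.Admits.flatMap {l : List (Fin n)} {v : Fin n → List (Fin m)}
    (hl : U.Admits l) (hv : U.Admits (List.ofFn v).flatten) : U.Admits (l.flatMap v) := by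
  have hfin : (List.ofFn v).flatten = (List.finRange n).flatMap v := by
    rw [List.flatMap_def, List.ofFn_eq_map]
  rw [hfin] at hv
  refine ⟨fun h => ?_, fun h i => ?_, fun h => ?_⟩
  · have h1 := hl.1 h
    have h2 := List.nodup_flatMap.1 (hv.1 h)
    refine List.nodup_flatMap.2 ⟨fun i _ => h2.1 i (List.mem_finRange i), ?_⟩
    have : Std.Symm (Function.onFun List.Disjoint v) := ⟨fun _ _ h => h.symm⟩
    refine h1.imp fun {i j} hij => ?_
    exact h2.2.forall (List.mem_finRange i) (List.mem_finRange j) hij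
  · obtain ⟨j, _, hj⟩ := List.mem_flatMap.1 (hv.2.1 h i)
    exact List.mem_flatMap.2 ⟨j, hl.2.1 h j, hj⟩
  · rw [hl.2.2 h]; exact hv.2.2 h

/-- Composition of updates, in diagrammatic order. -/
def Update.comp (u : Update Γ U n m) (v : Update Γ U m k) : Update Γ U n k where
  terms j := (v.terms j).subst u.terms
  admits := by
    convert v.admits.flatMap u.admits using 1
    simp only [Term.vars_subst]
    simp only [List.flatMap_def, List.map_flatten, List.flatten_flatten, List.map_ofFn,
      Function.comp_def]

theorem Update.comp_eval (u : Update Γ U n m) (v : Update Γ U m k) (d : Data Γ n) :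
    (u.comp v).eval d = v.eval (u.eval d) :=
  funext fun _ => Term.subst_subst _ _ _

/-- The identity update. -/
def Update.id (U : UpdateClass) (n : ℕ) : Update Γ U n n where
  terms := Term.var
  admits := by
    have h : (List.ofFn fun j : Fin n => (Term.var j : Term Γ n).vars).flatten =
        List.finRange n := by
      simp only [Term.vars, List.ofFn_eq_map]
      rw [← List.flatMap_def, List.flatMap_singleton']
    rw [h]
    exact ⟨fun _ => List.nodup_finRange n, fun _ => List.mem_finRange, fun _ => rfl⟩

theorem Update.const_eval (c : Data Γ n) (d : Data Γ 0) : (Update.const U c).eval d = c :=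
  funext fun _ => Term.subst_eq_self _ _

/-- The preimage of an equation under an update. -/
def Equation.comap (u : Update Γ U n m) (e : Equation Γ U m) : Equation Γ U n :=
  ⟨e.width, u.comp e.lhs, u.comp e.rhs⟩

theorem Equation.comap_holds {u : Update Γ U n m} {e : Equation Γ U m} {d : Data Γ n} :
    (e.comap u).Holds d ↔ e.Holds (u.eval d) := by
  rw [Equation.Holds, Equation.comap, Update.comp_eval, Update.comp_eval]; rfl

theorem subset_cl (D : Set (Data Γ n)) : D ⊆ cl U D := fun _ hd _ he => he _ hd

/-- Together with `subset_cl`, this is the minimality that makes `cl` the smallest constrained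
domain. -/
theorem cl_subset_sol {D : Set (Data Γ n)} {γ : Set (Equation Γ U n)} (h : D ⊆ Sol γ) :
    cl U D ⊆ Sol γ := fun _ hd e he => hd e fun _ hx => h hx e he

theorem cl_mono {D E : Set (Data Γ n)} (h : D ⊆ E) : cl U D ⊆ cl U E :=
  cl_subset_sol (h.trans (subset_cl E))

theorem cl_subset_cl {D E : Set (Data Γ n)} (h : D ⊆ cl U E) : cl U D ⊆ cl U E :=
  cl_subset_sol h

/-- Continuity of updates: the pullback of an equation of `γ` along `u` is again an equation, it is
valid on `D`, and therefore on the closure of `D`. -/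
theorem eval_mem_sol_of_mem_cl {D : Set (Data Γ n)} {γ : Set (Equation Γ U m)}
    {u : Update Γ U n m} (h : ∀ d ∈ D, u.eval d ∈ Sol γ) {d : Data Γ n} (hd : d ∈ cl U D) :
    u.eval d ∈ Sol γ :=
  fun e he => Equation.comap_holds.1 (hd (e.comap u) fun x hx =>
    Equation.comap_holds.2 (h x hx e he))

/-- The pair of updates is itself one of the equations that define the closure. -/
theorem eval_eq_eval_of_mem_cl {D : Set (Data Γ n)} {u v : Update Γ U n m}
    (h : ∀ d ∈ D, u.eval d = v.eval d) {d : Data Γ n} (hd : d ∈ cl U D) :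
    u.eval d = v.eval d :=
  hd ⟨m, u, v⟩ h

end

section
variable {Γ : RankedAlphabet} {U : UpdateClass} {X Y : Space Γ U}

/-! ### Closures of sets of configurations -/

/-- The data of the configurations in `S` with control state `q`. -/
def Space.slice (X : Space Γ U) (S : Set X.Config) (q : X.State) : Set (Data Γ (X.rank q)) :=
  {d | ∃ h : d ∈ X.data q, (⟨q, d, h⟩ : X.Config) ∈ S}

theorem Space.mem_slice {S : Set X.Config} {x : X.Config} (h : x ∈ S) :
    x.2.1 ∈ X.slice S x.1 := ⟨x.2.2, h⟩

theorem Space.cl_slice_subset_data (S : Set X.Config) (q : X.State) :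
    cl U (X.slice S q) ⊆ X.data q :=
  cl_subset_sol fun _ h => h.1

theorem Space.subset_closure (S : Set X.Config) : S ⊆ X.closure S :=
  fun _ hx => subset_cl _ (Space.mem_slice hx)

theorem Space.closure_subset_closure {S T : Set X.Config} (h : S ⊆ X.closure T) :
    X.closure S ⊆ X.closure T :=
  fun _ hx => cl_subset_cl (fun _ hd => h hd.2) hx

theorem Space.closure_mono {S T : Set X.Config} (h : S ⊆ T) : X.closure S ⊆ X.closure T :=
  Space.closure_subset_closure (h.trans (Space.subset_closure T))

theorem Transf.apply_eq_some {f : Transf X Y} {x : X.Config} {y : Y.Config} :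
    f.apply x = some y ↔ ∃ m, f.move x.1 = some m ∧
      (⟨m.1, m.2.1.eval x.2.1, m.2.2 _ x.2.2⟩ : Y.Config) = y := by
  exact Option.map_eq_some_iff

/-- The update and the target state depend only on the source state, so continuity of updates
applies state by state. -/
theorem Transf.mem_closure_of_apply {f : Transf X Y} {S : Set X.Config} {T : Set Y.Config}
    (h : ∀ x ∈ S, ∀ y, f.apply x = some y → y ∈ Y.closure T) {x : X.Config}
    (hx : x ∈ X.closure S) {y : Y.Config} (hy : f.apply x = some y) : y ∈ Y.closure T := by
  obtain ⟨q, d, hd⟩ := x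
  obtain ⟨⟨r, u, hu⟩, hm, rfl⟩ := Transf.apply_eq_some.1 hy
  refine eval_mem_sol_of_mem_cl (D := X.slice S q) (fun d' hd' => ?_) hx
  exact h _ hd'.2 _ (Transf.apply_eq_some.2 ⟨_, hm, rfl⟩)

/-! ### Reachable configurations -/

variable {A : Type} (B : Transducer Γ U A)

/-- The configurations reached by an internal transformation from a configuration in `S`. -/
def Transducer.post (S : Set B.space.Config) : Set B.space.Config :=
  {x | ∃ a, ∃ y ∈ S, (B.step a).apply y = some x}

/-- The configurations reached on the words of length at most `n`. -/
def Transducer.reachedWithin : ℕ → Set B.space.Config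
  | 0 => {x | B.init.apply (initConfig Γ U) = some x}
  | n + 1 => reachedWithin n ∪ B.post (reachedWithin n)

theorem Transducer.reachedWithin_mono : Monotone B.reachedWithin :=
  monotone_nat_of_le_succ fun _ => Set.subset_union_left

theorem Transducer.reach_concat (w : List A) (a : A) :
    B.reach (w ++ [a]) = (B.reach w).bind (B.step a).apply := by
  simp [Transducer.reach]

theorem Transducer.reachedWithin_subset (n : ℕ) : B.reachedWithin n ⊆ B.reachable := by
  induction n with
  | zero => exact fun x hx => ⟨[], hx⟩
  | succ n ih =>
    rintro x (hx | ⟨a, y, hy, hx⟩)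
    · exact ih hx
    · obtain ⟨w, hw⟩ := ih hy
      exact ⟨w ++ [a], by rw [B.reach_concat, hw]; exact hx⟩

theorem Transducer.exists_mem_reachedWithin {x : B.space.Config} (hx : x ∈ B.reachable) :
    ∃ n, x ∈ B.reachedWithin n := by
  obtain ⟨w, hw⟩ := hx
  induction w using List.reverseRecOn generalizing x with
  | nil => exact ⟨0, hw⟩
  | append_singleton w a ih =>
    rw [B.reach_concat, Option.bind_eq_some_iff] at hw
    obtain ⟨y, hy, hx⟩ := hw
    obtain ⟨n, hn⟩ := ih hy
    exact ⟨n + 1, Or.inr ⟨a, y, hn, hx⟩⟩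

theorem Transducer.init_mem_reachable {x : B.space.Config}
    (h : B.init.apply (initConfig Γ U) = some x) : x ∈ B.reachable :=
  B.reachedWithin_subset 0 h

theorem Transducer.step_mem_reachable {a : A} {x y : B.space.Config} (hx : x ∈ B.reachable)
    (h : (B.step a).apply x = some y) : y ∈ B.reachable := by
  obtain ⟨n, hn⟩ := B.exists_mem_reachedWithin hx
  exact B.reachedWithin_subset (n + 1) (Or.inr ⟨a, x, hn, h⟩)

theorem Transducer.post_closure_subset (S : Set B.space.Config) :
    B.post (B.space.closure S) ⊆ B.space.closure (B.post S) := by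
  rintro x ⟨a, y, hy, hx⟩
  exact Transf.mem_closure_of_apply
    (fun z hz w hw => Space.subset_closure _ (show w ∈ B.post S from ⟨a, z, hz, hw⟩)) hy hx

theorem Transducer.invariantStep_eq (S : Set B.space.Config) :
    B.invariantStep S = B.space.closure (S ∪ B.reachedWithin 0 ∪ B.post S) := rfl

theorem Transducer.post_mono {S T : Set B.space.Config} (h : S ⊆ T) : B.post S ⊆ B.post T :=
  fun _ ⟨a, y, hy, hx⟩ => ⟨a, y, h hy, hx⟩

/-- By continuity, closing before the step adds nothing that closing afterwards does not add. The
iteration can thus be run on plain sets of reached configurations and closed once at the end. -/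
theorem Transducer.invariantStep_closure (S : Set B.space.Config) :
    B.invariantStep (B.space.closure S) =
      B.space.closure (S ∪ B.reachedWithin 0 ∪ B.post S) := by
  rw [B.invariantStep_eq]
  refine Set.Subset.antisymm (Space.closure_subset_closure ?_) (Space.closure_mono ?_)
  · refine Set.union_subset (Set.union_subset (Space.closure_mono ?_) ?_)
      ((B.post_closure_subset S).trans (Space.closure_mono Set.subset_union_right))
    · exact Set.subset_union_left.trans Set.subset_union_left
    · exact (Set.subset_union_right.trans Set.subset_union_left).trans (Space.subset_closure _)
  · exact Set.union_subset_union (Set.union_subset_union_left _ (Space.subset_closure S))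
      (B.post_mono (Space.subset_closure S))

theorem Transducer.invariantStep_closure_reachedWithin (n : ℕ) :
    B.invariantStep (B.space.closure (B.reachedWithin n)) =
      B.space.closure (B.reachedWithin (n + 1)) := by
  rw [B.invariantStep_closure, Set.union_eq_left.2 (B.reachedWithin_mono (Nat.zero_le n))]
  rfl

theorem Transducer.iterate_invariantStep (n : ℕ) :
    B.invariantStep^[n + 1] ∅ = B.space.closure (B.reachedWithin n) := by
  induction n with
  | zero =>
    -- The first application to the empty set contributes only the initial configuration, whence the
    -- shift by one between iterations and word lengths.
    have h : B.post ∅ = ∅ := Set.eq_empty_of_forall_notMem fun x ⟨_, _, hy, _⟩ => hy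
    rw [zero_add, Function.iterate_one, B.invariantStep_eq, h, Set.union_empty, Set.empty_union]
  | succ n ih =>
    rw [Function.iterate_succ_apply', ih, B.invariantStep_closure_reachedWithin]

theorem Transducer.isLeast_closure_reachable :
    IsLeast (Function.fixedPoints B.invariantStep) (B.space.closure B.reachable) := by
  constructor
  · have h : B.reachable ∪ B.reachedWithin 0 ∪ B.post B.reachable = B.reachable := by
      rw [Set.union_eq_left.2 (B.reachedWithin_subset 0)]
      exact Set.union_eq_left.2 fun x ⟨a, y, hy, hx⟩ => B.step_mem_reachable hy hx
    rw [Function.mem_fixedPoints, Function.IsFixedPt, B.invariantStep_closure, h]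
  · intro S hS
    have hS' : B.space.closure (S ∪ B.reachedWithin 0 ∪ B.post S) = S := hS
    have hsub : S ∪ B.reachedWithin 0 ∪ B.post S ⊆ S :=
      (Space.subset_closure _).trans hS'.subset
    have hn : ∀ n, B.reachedWithin n ⊆ S := by
      intro n
      induction n with
      | zero => exact (Set.subset_union_right.trans Set.subset_union_left).trans hsub
      | succ n ih =>
        exact Set.union_subset ih
          ((B.post_mono ih).trans (Set.subset_union_right.trans hsub))
    refine (Space.closure_mono fun x hx => ?_).trans hS'.subset
    obtain ⟨n, h⟩ := B.exists_mem_reachedWithin hx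
    exact Or.inl (Or.inl (hn n h))

/-- Each closure is a function of the preceding one alone, so an equality of consecutive closures
propagates. -/
theorem Transducer.closure_reachedWithin_succ_eq {n : ℕ}
    (h : B.space.closure (B.reachedWithin n) = B.space.closure (B.reachedWithin (n + 1))) :
    B.space.closure (B.reachedWithin (n + 1)) = B.space.closure (B.reachedWithin (n + 2)) := by
  rw [← B.invariantStep_closure_reachedWithin, h, B.invariantStep_closure_reachedWithin]

theorem Transducer.closure_reachedWithin_eq {n : ℕ}
    (h : B.space.closure (B.reachedWithin n) = B.space.closure (B.reachedWithin (n + 1))) :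
    B.space.closure (B.reachedWithin n) = B.space.closure B.reachable := by
  have h1 : ∀ k, B.space.closure (B.reachedWithin (n + k)) =
        B.space.closure (B.reachedWithin (n + k + 1)) := by
    intro k
    induction k with
    | zero => exact h
    | succ k ih => exact B.closure_reachedWithin_succ_eq ih
  have h2 : ∀ k, B.space.closure (B.reachedWithin (n + k)) =
        B.space.closure (B.reachedWithin n) := by
    intro k
    induction k with
    | zero => rfl
    | succ k ih => exact (h1 k).symm.trans ih
  refine Set.Subset.antisymm (Space.closure_mono (B.reachedWithin_subset n))
    (Space.closure_subset_closure fun x hx => ?_)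
  obtain ⟨k, hk⟩ := B.exists_mem_reachedWithin hx
  rw [← h2 k]
  exact Space.subset_closure _ (B.reachedWithin_mono (Nat.le_add_left k n) hk)

/-- The control states reached on the words of length at most `n`. -/
def Transducer.statesWithin (n : ℕ) : Set B.space.State :=
  {q | ∃ x ∈ B.reachedWithin n, x.1 = q}

theorem Transducer.statesWithin_mono : Monotone B.statesWithin :=
  fun _ _ h _ ⟨x, hx, hq⟩ => ⟨x, B.reachedWithin_mono h hx, hq⟩

/-- Whether a transition is defined, and its target, depend on the control state and not on the
datum. A transition from a state seen at stage n + 1 can thus be replayed from a configuration with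
the same state at stage n. -/
theorem Transducer.statesWithin_succ_eq {n : ℕ}
    (h : B.statesWithin n = B.statesWithin (n + 1)) :
    B.statesWithin (n + 1) = B.statesWithin (n + 2) := by
  refine Set.Subset.antisymm (B.statesWithin_mono (Nat.le_succ _)) ?_
  rintro _ ⟨x, hx | ⟨a, y, hy, hx⟩, rfl⟩
  · exact ⟨x, hx, rfl⟩
  · have hy' : y.1 ∈ B.statesWithin (n + 1) := ⟨y, hy, rfl⟩
    rw [← h] at hy'
    obtain ⟨z, hz, hzy⟩ := hy'
    obtain ⟨m, hm, rfl⟩ := Transf.apply_eq_some.1 hx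
    obtain ⟨q, d, hd⟩ := z
    obtain rfl : q = y.1 := hzy
    exact ⟨_, Or.inr ⟨a, _, hz, Transf.apply_eq_some.2 ⟨m, hm, rfl⟩⟩, rfl⟩

/-- The sets of states seen form an increasing chain that is constant from its first repetition on,
so the number of states bounds the number of strict steps. -/
theorem Transducer.mem_statesWithin_card [Finite B.space.State] {x : B.space.Config}
    (hx : x ∈ B.reachable) : x.1 ∈ B.statesWithin (Nat.card B.space.State) := by
  obtain ⟨n, hn⟩ := B.exists_mem_reachedWithin hx
  have hmono : Monotone fun n => (B.statesWithin n).ncard := fun i j h =>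
    Set.ncard_le_ncard (B.statesWithin_mono h) (Set.toFinite _)
  have heq : ∀ {i j}, i ≤ j → (B.statesWithin i).ncard = (B.statesWithin j).ncard →
      B.statesWithin i = B.statesWithin j := fun hij h =>
    Set.eq_of_subset_of_ncard_le (B.statesWithin_mono hij) h.ge (Set.toFinite _)
  have hstab := Nat.stabilises_of_monotone hmono
    (fun m => (Set.ncard_le_ncard (Set.subset_univ _)).trans_eq (Set.ncard_univ _))
    (fun m h => congrArg Set.ncard (B.statesWithin_succ_eq (heq (Nat.le_succ m) h)))
    (le_max_left (Nat.card B.space.State) n)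
  rw [heq (le_max_left _ n) hstab.symm]
  exact ⟨x, B.reachedWithin_mono (le_max_right _ _) hn, rfl⟩

end

section
variable {Γ : RankedAlphabet} {U : UpdateClass} {s : ℕ}

/-! ### Codes of configurations -/

/-- The code of a configuration. -/
def FinSpace.configCode (X : FinSpace Γ U) (x : X.toSpace.Config) : ℕ × List ℕ :=
  (Fin.val x.1, tupleCode x.2.1)

theorem Transf.code_getElem? {X Y : FinSpace Γ U} (f : Transf X.toSpace Y.toSpace)
    (q : Fin X.card) : f.code[q.1]?.getD none =
      (f.move q).map fun m => (Fin.val m.1, m.2.1.code) := by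
  simp [Transf.code]

theorem applyCode_code {X Y : FinSpace Γ U} (f : Transf X.toSpace Y.toSpace)
    (x : X.toSpace.Config) :
    applyCode f.code (X.configCode x) = (f.apply x).map Y.configCode := by
  have h := f.code_getElem? x.1
  rw [applyCode, FinSpace.configCode, h]
  rcases hm : f.move x.1 with _ | m
  · rw [show f.apply x = none from Option.map_eq_none_iff.2 hm]; rfl
  · rw [Transf.apply_eq_some.2 ⟨m, hm, rfl⟩]
    exact congrArg some (Prod.ext rfl (map_substCode_tupleCode x.2.1 m.2.1.terms))

theorem mem_reachCodes (B : FinTransducer Γ U s) {n : ℕ} {y : ℕ × List ℕ} :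
    y ∈ reachCodes B.code n ↔
      ∃ x ∈ B.toTransducer.reachedWithin n, B.space.configCode x = y := by
  induction n generalizing y with
  | zero =>
    have h0 : ((initSpace Γ U).configCode (initConfig Γ U)) = (0, []) := by
      simp [FinSpace.configCode, initConfig, tupleCode]
    have h := applyCode_code B.init (initConfig Γ U)
    rw [h0] at h
    have h' : reachCodes B.code 0 =
      ((B.init.apply (initConfig Γ U)).map B.space.configCode).toList := by rw [← h]; rfl
    rw [h']
    exact Option.mem_toList.trans Option.map_eq_some_iff
  | succ n ih =>
    have h' : reachCodes B.code (n + 1) = reachCodes B.code n ++ (reachCodes B.code n).flatMap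
        fun x => B.code.2.2.2.1.filterMap fun f => applyCode f x := by
      rw [reachCodes, Function.iterate_succ_apply', ← reachCodes]
    rw [h', List.mem_append, List.mem_flatMap, ih]
    simp only [List.mem_filterMap, ih]
    constructor
    · rintro (⟨x, hx, rfl⟩ | ⟨_, ⟨x, hx, rfl⟩, _, hf, h⟩)
      · exact ⟨x, Or.inl hx, rfl⟩
      · obtain ⟨a, rfl⟩ := (List.mem_ofFn' _ _).1 hf
        obtain ⟨z, hz, rfl⟩ :=
          Option.map_eq_some_iff.1 ((applyCode_code (B.step a) x).symm.trans h)
        exact ⟨z, Or.inr ⟨a, x, hx, hz⟩, rfl⟩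
    · rintro ⟨x, hx | ⟨a, y, hy, hx⟩, rfl⟩
      · exact Or.inl ⟨x, hx, rfl⟩
      · refine Or.inr ⟨_, ⟨y, hy, rfl⟩, (B.step a).code, (List.mem_ofFn' _ _).2 ⟨a, rfl⟩, ?_⟩
        exact (applyCode_code (B.step a) y).trans (Option.map_eq_some_iff.2 ⟨x, hx, rfl⟩)

theorem FinTransducer.length_spaceCode (B : FinTransducer Γ U s) :
    B.code.2.1.length = B.space.card := List.length_ofFn

/-! ### The pool of equations -/

theorem exists_equation_of_mem_poolCodes {B : FinTransducer Γ U s} {p : ℕ × List ℕ × List ℕ}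
    (hp : p ∈ poolCodes U B.code) :
    ∃ (q : Fin B.space.card) (e : Equation Γ U (B.space.rank q)), (q.1, e.code) = p := by
  simp only [poolCodes, List.mem_flatMap, List.mem_map, mem_reachCodes] at hp
  obtain ⟨_, ⟨x, _, rfl⟩, e, he, rfl⟩ := hp
  obtain ⟨e, rfl⟩ := exists_equation_of_mem_equationCodes he
  exact ⟨x.1, e, rfl⟩

/-- An equation valid on all data reached at this state within `n` letters holds in particular on
the datum there that contributed to the pool, so an equivalent equation was listed for that datum.
-/
theorem exists_mem_poolCodes (B : FinTransducer Γ U s) {n : ℕ} (hn : B.space.card ≤ n)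
    {x : B.space.toSpace.Config} (hx : x ∈ B.toTransducer.reachable)
    {e : Equation Γ U (B.space.rank x.1)}
    (he : ∀ d ∈ B.space.toSpace.slice (B.toTransducer.reachedWithin n) x.1, e.Holds d) :
    ∃ e' : Equation Γ U (B.space.rank x.1), ((x.1 : Fin _).1, e'.code) ∈ poolCodes U B.code ∧
      ∀ d, e'.Holds d ↔ e.Holds d := by
  have : Finite B.toTransducer.space.State := inferInstanceAs (Finite (Fin B.space.card))
  have hcard : Nat.card B.toTransducer.space.State = B.space.card := Nat.card_fin _
  obtain ⟨y, hy, hyx⟩ := B.toTransducer.mem_statesWithin_card hx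
  rw [hcard] at hy
  obtain ⟨q, dx, hdx⟩ := x
  obtain ⟨r, d, hd⟩ := y
  obtain rfl : r = q := hyx
  obtain ⟨e', he', heq⟩ := exists_mem_equationCodes
    (he d (Space.mem_slice (B.toTransducer.reachedWithin_mono hn hy)))
  refine ⟨e', ?_, heq⟩
  simp only [poolCodes, List.mem_flatMap, List.mem_map, mem_reachCodes, B.length_spaceCode]
  exact ⟨_, ⟨_, hy, rfl⟩, _, he', rfl⟩

/-- The equation coded by `p` holds on the data of the configurations in `S`. -/
def FinSpace.ValidCode (X : FinSpace Γ U) (S : Set X.toSpace.Config) (p : ℕ × List ℕ × List ℕ) :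
    Prop :=
  ∀ x ∈ S, Fin.val x.1 = p.1 → HoldsCode p.2 (tupleCode x.2.1)

theorem FinSpace.validCode_iff {X : FinSpace Γ U} {S : Set X.toSpace.Config} {q : Fin X.card}
    {e : Equation Γ U (X.rank q)} :
    X.ValidCode S (q.1, e.code) ↔ ∀ d ∈ X.toSpace.slice S q, e.Holds d := by
  constructor
  · rintro h d ⟨hd, hS⟩
    exact holdsCode_code.1 (h _ hS rfl)
  · rintro h ⟨r, d, hd⟩ hS hr
    obtain rfl : r = q := Fin.ext hr
    exact holdsCode_code.2 (h d ⟨hd, hS⟩)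

theorem FinSpace.validCode_mono {X : FinSpace Γ U} {S T : Set X.toSpace.Config} (h : S ⊆ T)
    {p : ℕ × List ℕ × List ℕ} (hp : X.ValidCode T p) : X.ValidCode S p :=
  fun x hx => hp x (h hx)

theorem FinSpace.validCode_of_closure_eq {X : FinSpace Γ U} {S T : Set X.toSpace.Config}
    (h : X.toSpace.closure S = X.toSpace.closure T) {q : Fin X.card}
    {e : Equation Γ U (X.rank q)} (hS : X.ValidCode S (q.1, e.code)) :
    X.ValidCode T (q.1, e.code) := by
  rw [FinSpace.validCode_iff] at hS ⊢
  rintro d ⟨hd, hT⟩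
  have h1 : (⟨q, d, hd⟩ : X.toSpace.Config) ∈ X.toSpace.closure S :=
    h.symm ▸ Space.subset_closure T hT
  exact h1 e hS

/-! ### Stabilization of the closures and their finite systems of equations -/

/-- Every equation valid at stage `n` is equivalent, at a reachable state, to one in the pool. If
the next stage refutes no pool equation, then it refutes no equation at all. -/
theorem closure_reachedWithin_eq_of_valid (B : FinTransducer Γ U s) {n : ℕ}
    (hn : B.space.card ≤ n)
    (h : ∀ p ∈ poolCodes U B.code, B.space.ValidCode (B.toTransducer.reachedWithin n) p →
      B.space.ValidCode (B.toTransducer.reachedWithin (n + 1)) p) :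
    B.toTransducer.space.closure (B.toTransducer.reachedWithin n) =
      B.toTransducer.space.closure (B.toTransducer.reachedWithin (n + 1)) := by
  refine Set.Subset.antisymm
    (Space.closure_mono (B.toTransducer.reachedWithin_mono (Nat.le_succ n)))
    (Space.closure_subset_closure fun x hx e he => ?_)
  obtain ⟨e', he', heq⟩ :=
    exists_mem_poolCodes B hn (B.toTransducer.reachedWithin_subset _ hx) he
  have h1 := h _ he' (FinSpace.validCode_iff.2 fun d hd => (heq d).2 (he d hd))
  exact (heq _).1 (FinSpace.validCode_iff.1 h1 _ (Space.mem_slice hx))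

/-- Enough words: the closure of the reachable configurations is attained. -/
theorem closure_reachedWithin_eq_closure_reachable (B : FinTransducer Γ U s) :
    B.toTransducer.space.closure (B.toTransducer.reachedWithin
      (B.code.2.1.length + (poolCodes U B.code).length)) =
      B.toTransducer.space.closure B.toTransducer.reachable := by
  classical
  rw [B.length_spaceCode]
  set T := B.toTransducer
  -- The pool equations refuted after `n` further letters: an increasing chain whose members are no
  -- larger than the pool.
  let R : ℕ → Finset (ℕ × List ℕ × List ℕ) := fun n => (poolCodes U B.code).toFinset.filter
    fun p => ¬ B.space.ValidCode (T.reachedWithin (B.space.card + n)) p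
  have hmono : Monotone R := fun i j hij =>
    Finset.monotone_filter_right _ fun p _ hp hv =>
      hp (FinSpace.validCode_mono (T.reachedWithin_mono (Nat.add_le_add_left hij _)) hv)
  have hclos : ∀ m, (R m).card = (R (m + 1)).card →
      T.space.closure (T.reachedWithin (B.space.card + m)) =
        T.space.closure (T.reachedWithin (B.space.card + m + 1)) := by
    intro m hm
    refine closure_reachedWithin_eq_of_valid B (Nat.le_add_right _ _) fun p hp hv => ?_
    by_contra hv'
    have h1 : p ∈ R (m + 1) := Finset.mem_filter.2 ⟨List.mem_toFinset.2 hp, hv'⟩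
    rw [← Finset.eq_of_subset_of_card_le (hmono (Nat.le_succ m)) hm.ge] at h1
    exact (Finset.mem_filter.1 h1).2 hv
  -- A monotone bounded sequence that stays constant once it repeats has stabilized at its bound;
  -- comparing the pool length with its successor gives the required pair of consecutive stages.
  have hstab := Nat.stabilises_of_monotone (f := fun n => (R n).card)
    (b := (poolCodes U B.code).length) (n := (poolCodes U B.code).length + 1)
    (fun i j hij => Finset.card_le_card (hmono hij))
    (fun m => (Finset.card_filter_le _ _).trans (List.toFinset_card_le _))
    (fun m hm => congrArg Finset.card (Finset.Subset.antisymm (hmono (Nat.le_succ _)) ?_))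
    (Nat.le_succ _)
  · exact T.closure_reachedWithin_eq (hclos _ hstab.symm)
  · intro p hp
    obtain ⟨hp1, hp2⟩ := Finset.mem_filter.1 hp
    refine Finset.mem_filter.2 ⟨hp1, fun hv => hp2 ?_⟩
    obtain ⟨q, e, rfl⟩ := exists_equation_of_mem_poolCodes (List.mem_toFinset.1 hp1)
    -- If no new equation is refuted at stage m + 1, the closures at m and m + 1 agree, hence also
    -- those at m + 1 and m + 2, and the latter two stages validate the same equations.
    exact FinSpace.validCode_of_closure_eq (T.closure_reachedWithin_succ_eq (hclos m hm)) hv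

theorem mem_domainCodes {B : FinTransducer Γ U s} {q : ℕ} {c : List ℕ × List ℕ} :
    c ∈ domainCodes U B.code q ↔ (q, c) ∈ poolCodes U B.code ∧
      B.space.ValidCode (B.toTransducer.reachedWithin
        (B.code.2.1.length + (poolCodes U B.code).length)) (q, c) := by
  simp only [domainCodes, List.mem_map, List.mem_filter]
  constructor
  · rintro ⟨⟨_, c⟩, ⟨hp, h⟩, rfl⟩
    obtain ⟨rfl, h⟩ := of_decide_eq_true h
    refine ⟨hp, fun x hx hxq => ?_⟩
    exact (h _ ((mem_reachCodes B).2 ⟨x, hx, rfl⟩)).resolve_left (not_not_intro hxq)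
  · rintro ⟨hp, h⟩
    refine ⟨(q, c), ⟨hp, decide_eq_true ⟨rfl, fun y hy => ?_⟩⟩, rfl⟩
    obtain ⟨x, hx, rfl⟩ := (mem_reachCodes B).1 hy
    exact or_iff_not_imp_left.2 fun hxq => h x hx (not_not.1 hxq)

/-- The computed systems of equations define the closures of the sets of reachable data. -/
theorem exists_equations_domainCodes (B : FinTransducer Γ U s) {q : Fin B.space.card}
    (hq : ∃ x ∈ B.toTransducer.reachable, x.1 = q) :
    ∃ l : List (Equation Γ U (B.space.rank q)),
      l.map Equation.code = domainCodes U B.code q ∧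
      Sol {e | e ∈ l} = cl U (B.space.toSpace.slice B.toTransducer.reachable q) := by
  have hcl := closure_reachedWithin_eq_closure_reachable B
  set T := B.toTransducer
  set N := B.code.2.1.length + (poolCodes U B.code).length with hN
  obtain ⟨l, hl⟩ := exists_map_eq (f := (Equation.code : Equation Γ U (B.space.rank q) → _))
    (l := domainCodes U B.code q) fun c hc => by
      obtain ⟨q', e, he⟩ := exists_equation_of_mem_poolCodes (mem_domainCodes.1 hc).1
      obtain ⟨h1, h2⟩ := Prod.mk.inj he
      obtain rfl : q' = q := Fin.ext h1
      exact ⟨e, h2⟩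
  refine ⟨l, hl, Set.Subset.antisymm (fun d hd e he => ?_) (cl_subset_sol fun d hd e he => ?_)⟩
  -- Completeness: an equation valid on all reachable data has an equivalent in the pool, and this
  -- one passes the test on the witnesses. The state must be reached, as otherwise the pool contains
  -- nothing for it.
  · obtain ⟨x, hx, rfl⟩ := hq
    have he' : ∀ d ∈ B.space.toSpace.slice (T.reachedWithin N) x.1, e.Holds d :=
      fun d hd => he d ⟨hd.1, T.reachedWithin_subset N hd.2⟩
    obtain ⟨e', hp, heq⟩ := exists_mem_poolCodes B
      (hN ▸ B.length_spaceCode ▸ Nat.le_add_right _ _) hx he'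
    have hmem : e'.code ∈ domainCodes U B.code (x.1 : Fin _).1 :=
      mem_domainCodes.2 ⟨hp, FinSpace.validCode_iff.2 fun d hd => (heq d).2 (he' d hd)⟩
    rw [← hl] at hmem
    obtain ⟨e'', he'', hcode⟩ := List.mem_map.1 hmem
    rw [← heq, ← holdsCode_code, ← hcode, holdsCode_code]
    exact hd e'' he''
  -- Soundness: a retained equation was tested only on short words, but the closure has stabilized,
  -- so it is valid on all reachable data.
  · have hmem : e.code ∈ domainCodes U B.code q := hl ▸ List.mem_map_of_mem he
    exact FinSpace.validCode_iff.1
      (FinSpace.validCode_of_closure_eq hcl (mem_domainCodes.1 hmem).2) d hd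

theorem mem_stateCodes {B : FinTransducer Γ U s} {q : ℕ} :
    q ∈ stateCodes U B.code ↔ ∃ x ∈ B.toTransducer.reachable, Fin.val x.1 = q := by
  simp only [stateCodes, List.mem_filter, List.mem_range, decide_eq_true_eq, witnessCodes,
    B.length_spaceCode]
  constructor
  · rintro ⟨_, y, hy, rfl⟩
    obtain ⟨x, hx, rfl⟩ := (mem_reachCodes B).1 hy
    exact ⟨x, B.toTransducer.reachedWithin_subset _ hx, rfl⟩
  · rintro ⟨x, hx, rfl⟩
    have : Finite B.toTransducer.space.State := inferInstanceAs (Finite (Fin B.space.card))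
    have hcard : Nat.card B.toTransducer.space.State = B.space.card := Nat.card_fin _
    obtain ⟨y, hy, hyx⟩ := B.toTransducer.mem_statesWithin_card hx
    refine ⟨Fin.isLt _, _, (mem_reachCodes B).2 ⟨y, ?_, rfl⟩, congrArg Fin.val hyx⟩
    exact B.toTransducer.reachedWithin_mono (hcard ▸ Nat.le_add_right _ _) hy

end

section
variable {Γ : RankedAlphabet} {U : UpdateClass} {X Y : Space Γ U}

/-! ### Epis -/

/-- The image of a transformation, as a set of configurations. -/
def Transf.image (f : Transf X Y) : Set Y.Config := {y | ∃ x, f.apply x = some y}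

/-- At each state, one point of the image decides whether two transformations that agree on the
image are defined there and what their target is; their updates then agree on the image, and hence
on its closure. -/
theorem Transf.isEpi_of_image {f : Transf X Y}
    (hf : ∀ y : Y.Config, y ∈ Y.closure f.image ∧ ∃ y' ∈ f.image, y'.1 = y.1) : f.IsEpi := by
  intro Z h h' hcomp
  have heq : ∀ y ∈ f.image, h.apply y = h'.apply y := by
    rintro y ⟨x, hx⟩
    have h1 := congrFun hcomp x
    simpa only [Transf.comp, hx, Option.bind_some] using h1
  funext y
  obtain ⟨hy, y', hy', hyy'⟩ := hf y
  obtain ⟨q, d, hd⟩ := y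
  obtain ⟨q', d', hd'⟩ := y'
  obtain rfl : q' = q := hyy'
  have h1 := heq _ hy'
  rcases hm : h.move q' with _ | ⟨r, u, hu⟩ <;> rcases hm' : h'.move q' with _ | ⟨r', u', hu'⟩
  · exact (Option.map_eq_none_iff.2 hm).trans (Option.map_eq_none_iff.2 hm').symm
  · have hn : h.apply ⟨q', d', hd'⟩ = none := Option.map_eq_none_iff.2 hm
    cases hn.symm.trans (h1.trans (Transf.apply_eq_some.2 ⟨_, hm', rfl⟩))
  · have hn : h'.apply ⟨q', d', hd'⟩ = none := Option.map_eq_none_iff.2 hm'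
    cases hn.symm.trans (h1.symm.trans (Transf.apply_eq_some.2 ⟨_, hm, rfl⟩))
  · have happ : ∀ d hd, h.apply ⟨q', d, hd⟩ = some ⟨r, u.eval d, hu d hd⟩ :=
      fun d hd => Transf.apply_eq_some.2 ⟨_, hm, rfl⟩
    have happ' : ∀ d hd, h'.apply ⟨q', d, hd⟩ = some ⟨r', u'.eval d, hu' d hd⟩ :=
      fun d hd => Transf.apply_eq_some.2 ⟨_, hm', rfl⟩
    rw [happ, happ'] at h1
    obtain rfl : r = r' := congrArg Sigma.fst (Option.some.inj h1)
    have key : u.eval d = u'.eval d := by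
      refine eval_eq_eval_of_mem_cl (D := Y.slice f.image q') (fun d hd => ?_) hy
      have h2 := heq _ hd.2
      rw [happ, happ'] at h2
      have h3 := eq_of_heq (Sigma.mk.inj (Option.some.inj h2)).2
      exact congrArg Subtype.val h3
    rw [happ, happ']
    simp only [key]

/-- The space with a single, unconstrained state. -/
def Space.single (Γ : RankedAlphabet) (U : UpdateClass) (n : ℕ) : Space Γ U where
  State := Unit
  rank _ := n
  constraint _ := ∅

open Classical in
/-- The transformation to an unconstrained space defined only at the state `p`. -/
noncomputable def Transf.single (p : Y.State) {n : ℕ} (u : Update Γ U (Y.rank p) n) :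
    Transf Y (Space.single Γ U n) where
  move q := if h : q = p then some ⟨(), h ▸ u, fun _ _ _ he => absurd he id⟩ else none

theorem Transf.single_apply_self {p : Y.State} {n : ℕ} {u : Update Γ U (Y.rank p) n}
    {d : Data Γ (Y.rank p)} {hd : d ∈ Y.data p} :
    (Transf.single p u).apply ⟨p, d, hd⟩ = some ⟨(), u.eval d, fun _ he => absurd he id⟩ :=
  Transf.apply_eq_some.2 ⟨_, dif_pos rfl, rfl⟩

theorem Transf.single_apply_of_ne {p : Y.State} {n : ℕ} {u : Update Γ U (Y.rank p) n}
    {y : Y.Config} (h : y.1 ≠ p) : (Transf.single p u).apply y = none :=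
  Option.map_eq_none_iff.2 (dif_neg h)

/-- If the image missed the state, `f` could not distinguish a transformation defined only there
from the nowhere defined one. -/
theorem Transf.IsEpi.exists_mem_image {f : Transf X Y} (hf : f.IsEpi) (y : Y.Config) :
    ∃ y' ∈ f.image, y'.1 = y.1 := by
  by_contra! hne
  have h := hf (Space.single Γ U _) (Transf.single y.1 (Update.id U _)) ⟨fun _ => none⟩ ?_
  · exact Option.some_ne_none _ (Transf.single_apply_self.symm.trans (congrFun h y))
  · funext x
    rcases hx : f.apply x with _ | y'
    · simp only [Transf.comp, hx, Option.bind_none]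
    · simp only [Transf.comp, hx, Option.bind_some]
      exact Transf.single_apply_of_ne (hne y' ⟨x, hx⟩)

/-- The two sides of an equation valid on the image give two transformations that agree after `f`;
as `f` is epi, they agree everywhere at that state. -/
theorem Transf.IsEpi.mem_closure_image {f : Transf X Y} (hf : f.IsEpi) (y : Y.Config) :
    y ∈ Y.closure f.image := by
  intro e he
  have h := hf (Space.single Γ U _) (Transf.single y.1 e.lhs) (Transf.single y.1 e.rhs) ?_
  · have h1 := Transf.single_apply_self.symm.trans
      ((congrFun h y).trans Transf.single_apply_self)
    exact congrArg Subtype.val (eq_of_heq (Sigma.mk.inj (Option.some.inj h1)).2)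
  · funext x
    rcases hx : f.apply x with _ | y'
    · simp only [Transf.comp, hx, Option.bind_none]
    · simp only [Transf.comp, hx, Option.bind_some]
      by_cases hy : y'.1 = y.1
      · obtain ⟨q, d, hd⟩ := y
        obtain ⟨q', d', hd'⟩ := y'
        obtain rfl : q' = q := hy
        have h1 : e.lhs.eval d' = e.rhs.eval d' := he d' ⟨hd', x, hx⟩
        rw [Transf.single_apply_self, Transf.single_apply_self]
        simp only [h1]
      · rw [Transf.single_apply_of_ne hy, Transf.single_apply_of_ne hy]

/-! ### Restrictions of configuration spaces -/

/-- The restriction of a space to some of its states (up to renaming), with other constraints. -/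
abbrev Space.restrict (Y : Space Γ U) {σ : Type} (ι : σ → Y.State)
    (γ : (k : σ) → Set (Equation Γ U (Y.rank (ι k)))) : Space Γ U where
  State := σ
  rank k := Y.rank (ι k)
  constraint := γ

variable {σ : Type} {ι : σ → Y.State} {γ : (k : σ) → Set (Equation Γ U (Y.rank (ι k)))}

/-- The inclusion of a restriction, on configurations. -/
def Space.incl (hγ : ∀ k, Sol (γ k) ⊆ Y.data (ι k)) (x : (Y.restrict ι γ).Config) : Y.Config :=
  ⟨ι x.1, x.2.1, hγ _ x.2.2⟩

theorem Space.incl_injective (hγ : ∀ k, Sol (γ k) ⊆ Y.data (ι k)) (hι : Function.Injective ι) :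
    Function.Injective (Space.incl hγ) := by
  rintro ⟨k, d, hd⟩ ⟨k', d', hd'⟩ h
  obtain rfl : k = k' := hι (congrArg Sigma.fst h)
  obtain rfl : d = d' := congrArg Subtype.val (eq_of_heq (Sigma.mk.inj h).2)
  rfl

/-- The inclusion of a restriction. -/
def Transf.incl (hγ : ∀ k, Sol (γ k) ⊆ Y.data (ι k)) : Transf (Y.restrict ι γ) Y where
  move k := some ⟨ι k, Update.id U _, fun _ hd => hγ k hd⟩

theorem Transf.comp_incl (hγ : ∀ k, Sol (γ k) ⊆ Y.data (ι k)) (f : Transf X (Y.restrict ι γ))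
    (x : X.Config) : f.comp (Transf.incl hγ) x = (f.apply x).map (Space.incl hγ) := by
  rw [Transf.comp]
  rcases f.apply x with _ | y <;> rfl

/-- The action of a transformation at a state, without its compatibility with the domains. -/
def Transf.spec (f : Transf X Y) (q : X.State) :
    Option (Σ r : Y.State, Update Γ U (X.rank q) (Y.rank r)) :=
  (f.move q).map fun m => ⟨m.1, m.2.1⟩

theorem Transf.spec_eq_some {f : Transf X Y} {q : X.State} {r : Y.State}
    {u : Update Γ U (X.rank q) (Y.rank r)} :
    f.spec q = some ⟨r, u⟩ ↔
      ∃ hu : ∀ d ∈ X.data q, u.eval d ∈ Y.data r, f.move q = some ⟨r, u, hu⟩ := by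
  rw [Transf.spec, Option.map_eq_some_iff]
  constructor
  · rintro ⟨⟨r', u', hu'⟩, hm, h⟩
    cases h
    exact ⟨hu', hm⟩
  · rintro ⟨hu, hm⟩
    exact ⟨_, hm, rfl⟩

theorem Transf.spec_eq_none {f : Transf X Y} {q : X.State} : f.spec q = none ↔ f.move q = none :=
  Option.map_eq_none_iff

/-- Corestriction of one transition to a restricted space. It builds the diagonals for strong monos
as well as the initial and internal transformations of the image. Comparing bare updates, without
their compatibility proofs, makes the equality type-check across different domains. -/
theorem exists_lift {n : ℕ} {D : Set (Data Γ n)}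
    (m : Option (Σ r : Y.State, Update Γ U n (Y.rank r)))
    (hι : ∀ r u, m = some ⟨r, u⟩ → ∃ k, ι k = r)
    (hγ : ∀ k u, m = some ⟨ι k, u⟩ → ∀ d ∈ D, u.eval d ∈ Sol (γ k)) :
    ∃ m' : Option (Σ k : σ, {u : Update Γ U n (Y.rank (ι k)) // ∀ d ∈ D, u.eval d ∈ Sol (γ k)}),
      m'.map (fun x => (⟨ι x.1, x.2.1⟩ : Σ r : Y.State, Update Γ U n (Y.rank r))) = m := by
  rcases m with _ | ⟨r, u⟩
  · exact ⟨none, rfl⟩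
  · obtain ⟨k, rfl⟩ := hι r u rfl
    exact ⟨some ⟨k, u, hγ k u rfl⟩, rfl⟩

theorem Transf.map_incl_apply (hγ : ∀ k, Sol (γ k) ⊆ Y.data (ι k))
    {g : Transf X (Y.restrict ι γ)} {f : Transf X Y} {x : X.Config}
    (h : (g.move x.1).map
      (fun m => (⟨ι m.1, m.2.1⟩ : Σ r : Y.State, Update Γ U (X.rank x.1) (Y.rank r))) =
        f.spec x.1) :
    (g.apply x).map (Space.incl hγ) = f.apply x := by
  rcases hg : g.move x.1 with _ | ⟨k, u, hu⟩
  · rw [hg] at h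
    rw [show g.apply x = none from Option.map_eq_none_iff.2 hg,
      show f.apply x = none from Option.map_eq_none_iff.2 (Transf.spec_eq_none.1 h.symm)]
    rfl
  · rw [hg] at h
    obtain ⟨hu', hf⟩ := Transf.spec_eq_some.1 h.symm
    rw [Transf.apply_eq_some.2 ⟨_, hg, rfl⟩, Transf.apply_eq_some.2 ⟨_, hf, rfl⟩]
    rfl

/-- The restriction of the domain of a transformation. -/
def Transf.restrictDom (hγ : ∀ k, Sol (γ k) ⊆ Y.data (ι k)) (f : Transf Y X) :
    Transf (Y.restrict ι γ) X where
  move k := (f.move (ι k)).map fun m => ⟨m.1, m.2.1, fun d hd => m.2.2 d (hγ k hd)⟩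

theorem Transf.restrictDom_spec (hγ : ∀ k, Sol (γ k) ⊆ Y.data (ι k)) (f : Transf Y X) (k : σ) :
    (f.restrictDom hγ).spec k = f.spec (ι k) := by
  rw [Transf.spec, Transf.spec, Transf.restrictDom]
  simp only [Option.map_map]
  rfl

theorem Transf.restrictDom_apply (hγ : ∀ k, Sol (γ k) ⊆ Y.data (ι k)) (f : Transf Y X)
    (x : (Y.restrict ι γ).Config) :
    (f.restrictDom hγ).apply x = f.apply (Space.incl hγ x) := by
  rcases hm : f.move (ι x.1) with _ | m
  · rw [show f.apply _ = none from Option.map_eq_none_iff.2 hm]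
    exact Option.map_eq_none_iff.2 (Option.map_eq_none_iff.2 hm)
  · have h1 : f.apply (Space.incl hγ x) = some _ := Transf.apply_eq_some.2 ⟨m, hm, rfl⟩
    rw [h1]
    exact Transf.apply_eq_some.2 ⟨_, Option.map_eq_some_iff.2 ⟨m, hm, rfl⟩, rfl⟩

/-- Inclusions of restrictions are strong monos. -/
theorem Transf.isStrongMono_incl (hγ : ∀ k, Sol (γ k) ⊆ Y.data (ι k))
    (hι : Function.Injective ι) : (Transf.incl hγ).IsStrongMono := by
  intro X Z f h h' hf hcomp
  have hinj := Option.map_injective (Space.incl_injective hγ hι)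
  have hsq : ∀ x z, f.apply x = some z → h'.apply z = (h.apply x).map (Space.incl hγ) := by
    intro x z hx
    rw [← Transf.comp_incl, ← hcomp, Transf.comp, hx, Option.bind_some]
  have hlift : ∀ p : Z.State, ∃ m' : Option (Σ k : σ,
      {u : Update Γ U (Z.rank p) (Y.rank (ι k)) // ∀ d ∈ Z.data p, u.eval d ∈ Sol (γ k)}),
      (Z.data p).Nonempty → m'.map
        (fun x => (⟨ι x.1, x.2.1⟩ : Σ r : Y.State, Update Γ U (Z.rank p) (Y.rank r))) =
          h'.spec p := by
    intro p
    -- A constrained domain may be empty, and an epi need not hit such a state. The diagonal is left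
    -- undefined there, which no configuration can detect.
    by_cases hp : (Z.data p).Nonempty
    · obtain ⟨d₀, hd₀⟩ := hp
      have happ : ∀ {r u}, h'.spec p = some ⟨r, u⟩ → ∀ x d hd, f.apply x = some ⟨p, d, hd⟩ →
          ∃ c, h.apply x = some c ∧ ι c.1 = r ∧
            ∀ k, r = ι k → ∃ hk : u.eval d ∈ Y.data r, Space.incl hγ c = ⟨r, u.eval d, hk⟩ := by
        intro r u hu x d hd hx
        obtain ⟨hu', hm⟩ := Transf.spec_eq_some.1 hu
        have h1 : h'.apply ⟨p, d, hd⟩ = some _ := Transf.apply_eq_some.2 ⟨_, hm, rfl⟩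
        obtain ⟨c, hc, hc'⟩ := Option.map_eq_some_iff.1 ((hsq x _ hx).symm.trans h1)
        exact ⟨c, hc, congrArg Sigma.fst hc', fun _ _ => ⟨hu' d hd, hc'⟩⟩
      obtain ⟨m', hm'⟩ := exists_lift (γ := γ) (D := Z.data p) (h'.spec p) (fun r u hu => by
          obtain ⟨⟨q, d, hd⟩, ⟨x, hx⟩, hq⟩ := hf.exists_mem_image ⟨p, d₀, hd₀⟩
          obtain rfl : q = p := hq
          obtain ⟨c, _, hc, _⟩ := happ hu x d hd hx
          exact ⟨c.1, hc⟩) (fun k u hu d hd => by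
          -- On the image of `f` the update agrees with `h`, whose values satisfy `γ`; the image is
          -- dense because `f` is epi, so continuity extends this to the whole domain.
          refine eval_mem_sol_of_mem_cl (D := Z.slice f.image p) (fun d' hd' => ?_)
            (hf.mem_closure_image ⟨p, d, hd⟩)
          obtain ⟨hd', x, hx⟩ := hd'
          obtain ⟨⟨k', c, hc⟩, _, hk', hincl⟩ := happ hu x d' hd' hx
          obtain rfl : k' = k := hι hk'
          obtain ⟨_, h1⟩ := hincl _ rfl
          have h2 : c = u.eval d' := congrArg Subtype.val (eq_of_heq (Sigma.mk.inj h1).2)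
          exact h2 ▸ hc)
      exact ⟨m', fun _ => hm'⟩
    · exact ⟨none, fun h => absurd h hp⟩
  choose mv hmv using hlift
  let g : Transf Z (Y.restrict ι γ) := ⟨mv⟩
  have hg : ∀ z, (g.apply z).map (Space.incl hγ) = h'.apply z := fun z =>
    Transf.map_incl_apply hγ (hmv z.1 ⟨_, z.2.2⟩)
  refine ⟨⟨g, ?_, ?_⟩, fun d d' _ hd _ hd' => ?_⟩
  · funext x
    -- The inclusion is injective, so commutation of the upper triangle can be checked after
    -- composing with it; uniqueness of the diagonal is obtained in the same way.
    apply hinj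
    rw [Transf.comp]
    rcases hx : f.apply x with _ | z
    · have h1 := congrFun hcomp x
      rw [Transf.comp_incl, Transf.comp, hx] at h1
      exact h1.symm
    · rw [Option.bind_some, hg, hsq x z hx]
  · funext z
    rw [Transf.comp_incl, hg]
  · funext z
    apply hinj
    rw [← Transf.comp_incl, ← Transf.comp_incl, ← hd, ← hd']

end

section
variable {Γ : RankedAlphabet} {U : UpdateClass} {A : Type}

/-! ### The arrow from the initial transducer and its factorization -/

theorem eq_initConfig (x : (initSpace Γ U).toSpace.Config) : x = initConfig Γ U := by
  obtain ⟨q, d, hd⟩ := x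
  obtain rfl : q = (0 : Fin 1) := Subsingleton.elim _ _
  obtain rfl : d = Fin.elim0 := funext fun i => i.elim0
  rfl

theorem haltConfig_eq (x y : (haltSpace Γ U).toSpace.Config) (h : x.2.1 = y.2.1) : x = y := by
  obtain ⟨q, d, hd⟩ := x
  obtain ⟨q', d', hd'⟩ := y
  obtain rfl : q = q' := Subsingleton.elim (α := Fin 1) _ _
  obtain rfl : d = d' := h
  rfl

/-- The morphism from the initial transducer, with its domain fixed up to the transduction. -/
def Transducer.initialTransf (C : Transducer Γ U A) (φ : List A → Option (Data Γ 1)) :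
    Transf (initialTransducer U φ).space C.space where
  move w := (C.reach w).map fun c => ⟨c.1, Update.const U c.2.1, fun d _ =>
    (Update.const_eval c.2.1 d).symm ▸ c.2.2⟩

theorem Transducer.initialTransf_apply (C : Transducer Γ U A) (φ : List A → Option (Data Γ 1))
    (x : (initialTransducer U φ).space.Config) : (C.initialTransf φ).apply x = C.reach x.1 := by
  rcases h : C.reach x.1 with _ | c
  · exact Option.map_eq_none_iff.2 (Option.map_eq_none_iff.2 h)
  · refine Transf.apply_eq_some.2 ⟨_, Option.map_eq_some_iff.2 ⟨c, h, rfl⟩, ?_⟩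
    refine Sigma.ext rfl (heq_of_eq (Subtype.ext ?_))
    exact Update.const_eval _ _

theorem Transducer.isMorphism_initialTransf (C : Transducer Γ U A) :
    (C.initialTransf C.transduction).IsMorphism (B := initialTransducer U C.transduction)
      (C := C) := by
  refine ⟨?_, fun a => ?_, ?_⟩
  · funext x
    rw [eq_initConfig x]
    exact C.initialTransf_apply _ _
  · funext x
    have h1 : ((initialTransducer U C.transduction).step a).comp
        (C.initialTransf C.transduction) x = C.reach (List.append x.1 [a]) :=
      C.initialTransf_apply _ _
    rw [h1, Transf.comp, C.initialTransf_apply]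
    exact C.reach_concat x.1 a
  · funext x
    rw [Transf.comp, C.initialTransf_apply]
    rcases h : (C.reach x.1).bind C.halt.apply with _ | y
    · have h2 : C.transduction x.1 = none := Option.map_eq_none_iff.2 h
      exact Option.map_eq_none_iff.2 (Option.map_eq_none_iff.2 h2)
    · have h2 : C.transduction x.1 = some y.2.1 := Option.map_eq_some_iff.2 ⟨y, h, rfl⟩
      refine Transf.apply_eq_some.2 ⟨_, Option.map_eq_some_iff.2 ⟨_, h2, rfl⟩, ?_⟩
      exact haltConfig_eq _ _ (Update.const_eval _ _)

/-- The restriction of a transducer to the closure of its reachable configurations is its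
initial image. -/
theorem isInitialImage_restrict (B : Transducer Γ U A) {σ : Type} {ι : σ → B.space.State}
    {γ : (k : σ) → Set (Equation Γ U (B.space.rank (ι k)))}
    (hγ : ∀ k, Sol (γ k) ⊆ B.space.data (ι k)) (hι : Function.Injective ι)
    (hrange : Set.range ι = {q | ∃ x ∈ B.reachable, x.1 = q})
    (hcl : ∀ k, Sol (γ k) = cl U (B.space.slice B.reachable (ι k)))
    {init : Transf (initSpace Γ U).toSpace (B.space.restrict ι γ)}
    {step : A → Transf (B.space.restrict ι γ) (B.space.restrict ι γ)}
    (hinit : ∀ x, (init.apply x).map (Space.incl hγ) = B.init.apply x)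
    (hstep : ∀ a x, ((step a).apply x).map (Space.incl hγ) =
      (B.step a).apply (Space.incl hγ x)) :
    IsInitialImage ⟨B.space.restrict ι γ, init, step, B.halt.restrictDom hγ⟩ B := by
  set C : Transducer Γ U A := ⟨B.space.restrict ι γ, init, step, B.halt.restrictDom hγ⟩
  have hreach : ∀ w, (C.reach w).map (Space.incl hγ) = B.reach w := by
    intro w
    induction w using List.reverseRecOn with
    | nil => exact hinit _
    | append_singleton w a ih =>
      rw [C.reach_concat, B.reach_concat, ← ih]
      rcases C.reach w with _ | c
      · rfl
      · exact hstep a c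
  have htrans : C.transduction = B.transduction := by
    funext w
    rw [Transducer.transduction, Transducer.transduction, ← hreach]
    rcases C.reach w with _ | c
    · rfl
    · exact congrArg (Option.map fun x : (haltSpace Γ U).toSpace.Config =>
        show Data Γ 1 from x.2.1) (Transf.restrictDom_apply hγ B.halt c)
  have himage : ∀ c : C.space.Config, c ∈ (C.initialTransf B.transduction).image ↔
      Space.incl hγ c ∈ B.reachable := by
    intro c
    constructor
    · rintro ⟨x, hx⟩
      rw [C.initialTransf_apply] at hx
      exact ⟨x.1, (hreach _).symm.trans (congrArg (Option.map (Space.incl hγ)) hx)⟩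
    · rintro ⟨w, hw⟩
      rw [← hreach] at hw
      obtain ⟨c', hc', heq⟩ := Option.map_eq_some_iff.1 hw
      obtain rfl := Space.incl_injective hγ hι heq
      exact ⟨⟨w, Fin.elim0, fun _ he => absurd he id⟩, (C.initialTransf_apply _ _).trans hc'⟩
  have hmorph := C.isMorphism_initialTransf
  -- The source must be the initial transducer for the transduction of `B`; it is the same one
  -- because the restriction realizes the same transduction.
  rw [htrans] at hmorph
  refine ⟨C.initialTransf B.transduction, Transf.incl hγ, ι, hmorph, ⟨?_, fun a => ?_, ?_⟩, ?_,
    Transf.isStrongMono_incl hγ hι, ?_, hι, hrange, fun x => ⟨Space.incl hγ x, rfl, rfl, rfl⟩, ?_⟩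
  · exact funext fun x => (Transf.comp_incl hγ init x).trans (hinit x)
  · exact funext fun x => (Transf.comp_incl hγ (step a) x).trans (hstep a x)
  · exact funext fun x => Transf.restrictDom_apply hγ B.halt x
  -- The image of the arrow consists of the reachable configurations, and the new domains are by
  -- `hcl` the closures of their data, so the image is dense and meets every state.
  · refine Transf.isEpi_of_image fun c => ⟨?_, ?_⟩
    · obtain ⟨k, d, hd⟩ := c
      have h1 : d ∈ cl U (B.space.slice B.reachable (ι k)) := hcl k ▸ hd
      refine cl_mono (fun d' hd' => ?_) h1
      have hd'' : d' ∈ Sol (γ k) := hcl k ▸ subset_cl _ hd'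
      exact ⟨hd'', (himage _).2 hd'.2⟩
    · have h1 : ι c.1 ∈ Set.range ι := ⟨c.1, rfl⟩
      rw [hrange] at h1
      obtain ⟨⟨q, d, hd⟩, hx, hq⟩ := h1
      obtain rfl : q = ι c.1 := hq
      have hd' : d ∈ Sol (γ c.1) := hcl c.1 ▸ subset_cl _ (Space.mem_slice hx)
      exact ⟨⟨c.1, d, hd'⟩, (himage _).2 hx, rfl⟩
  · funext x
    rw [Transf.comp_incl, C.initialTransf_apply]
    exact hreach x.1
  · ext y
    constructor
    · rintro ⟨x, hx⟩
      obtain rfl : Space.incl hγ x = y := Option.some.inj hx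
      have h1 : ι x.1 ∈ Set.range ι := ⟨x.1, rfl⟩
      rw [hrange] at h1
      have h2 : x.2.1 ∈ cl U (B.space.slice B.reachable (ι x.1)) := hcl x.1 ▸ x.2.2
      exact ⟨h2, h1⟩
    · rintro ⟨hy, hq⟩
      obtain ⟨k, hk⟩ : y.1 ∈ Set.range ι := hrange ▸ hq
      obtain ⟨q, d, hd⟩ := y
      obtain rfl : ι k = q := hk
      have hd' : d ∈ Sol (γ k) := hcl k ▸ hy
      exact ⟨⟨k, d, hd'⟩, rfl⟩

/-! ### The initial image of a finite transducer -/

variable {s : ℕ}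

theorem Transf.code_eq_spec {X Y : FinSpace Γ U} (f : Transf X.toSpace Y.toSpace) :
    f.code = List.ofFn fun q : Fin X.card =>
      (f.spec q).map fun m => (Fin.val m.1, m.2.code) := by
  simp only [Transf.code, Transf.spec, Option.map_map]
  rfl

/-- As `L` has no duplicates, looking up the index of `L[k]` returns `k`: relabelling on codes
undoes the inclusion of states. -/
theorem relabelCode_map {B : FinSpace Γ U} {L : List (Fin B.card)} (hL : L.Nodup) {n : ℕ}
    {P : (k : Fin L.length) → Update Γ U n (B.rank L[k]) → Prop}
    (m : Option (Σ k : Fin L.length, {u : Update Γ U n (B.rank L[k]) // P k u})) :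
    relabelCode (L.map Fin.val) ((m.map fun x =>
        (⟨L[x.1], x.2.1⟩ : Σ r : Fin B.card, Update Γ U n (B.rank r))).map
          fun m => (Fin.val m.1, m.2.code)) =
      m.map fun x => (Fin.val x.1, x.2.1.code) := by
  rcases m with _ | ⟨k, u, hu⟩
  · rfl
  · have h1 : (L.map Fin.val).idxOf (L[k]).1 = k.1 := by
      have h2 := (hL.map Fin.val_injective).idxOf_getElem k.1 (by simp)
      simpa using h2
    simp only [relabelCode, Option.map_some, h1]

/-- The states of `C` are the positions in the computed list of reached states, and its equations
are decoded from the computed systems. The corestricted transformations have the codes that the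
algorithm outputs, and the abstract restriction theorem applies. -/
theorem exists_initialImage (B : FinTransducer Γ U s) :
    ∃ C : FinTransducer Γ U s, imageCode U B.code = C.code ∧
      IsInitialImage C.toTransducer B.toTransducer := by
  obtain ⟨L, hL⟩ := exists_map_eq (f := (Fin.val : Fin B.space.card → ℕ))
    (l := stateCodes U B.code) fun q hq => by
      obtain ⟨x, _, hx⟩ := mem_stateCodes.1 hq
      exact ⟨x.1, hx⟩
  have hnodup : L.Nodup := by
    refine List.Nodup.of_map Fin.val ?_
    rw [hL]
    exact List.nodup_range.filter _
  have hmem : ∀ q, q ∈ L ↔ ∃ x ∈ B.toTransducer.reachable, x.1 = q := by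
    intro q
    have h1 : q ∈ L ↔ q.1 ∈ stateCodes U B.code := by
      rw [← hL, List.mem_map_of_injective Fin.val_injective]
    rw [h1, mem_stateCodes]
    exact exists_congr fun x => and_congr_right fun _ => Fin.val_inj
  let ι : Fin L.length → Fin B.space.card := fun k => L[k]
  have hι : Function.Injective ι := fun i j h => Fin.ext ((hnodup.getElem_inj_iff).1 h)
  have hreached : ∀ k, ∃ x ∈ B.toTransducer.reachable, x.1 = ι k :=
    fun k => (hmem _).1 (List.getElem_mem k.2)
  have hsurj : ∀ x ∈ B.toTransducer.reachable, ∃ k, ι k = x.1 := fun x hx => by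
    obtain ⟨i, hi, h⟩ := List.mem_iff_getElem.1 ((hmem x.1).2 ⟨x, hx, rfl⟩)
    exact ⟨⟨i, hi⟩, h⟩
  choose eqs heqs hcl using fun k => exists_equations_domainCodes B (hreached k)
  let γ : (k : Fin L.length) → Set (Equation Γ U (B.space.rank (ι k))) := fun k => {e | e ∈ eqs k}
  have hγ : ∀ k, Sol (γ k) ⊆ B.space.toSpace.data (ι k) := fun k =>
    (hcl k).subset.trans (Space.cl_slice_subset_data _ _)
  have hslice : ∀ k, B.space.toSpace.slice B.toTransducer.reachable (ι k) ⊆ Sol (γ k) :=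
    fun k => (subset_cl _).trans (hcl k).superset
  choose initMove hinit using fun q : Fin 1 => exists_lift (γ := γ)
    (D := (initSpace Γ U).toSpace.data q) (B.init.spec q) (fun r u hu => by
      obtain ⟨hu', hm⟩ := Transf.spec_eq_some.1 hu
      obtain rfl : q = 0 := Subsingleton.elim _ _
      exact hsurj _ (B.toTransducer.init_mem_reachable
        (Transf.apply_eq_some.2 ⟨_, hm, rfl⟩))) (fun k u hu d hd => by
      obtain ⟨hu', hm⟩ := Transf.spec_eq_some.1 hu
      refine hslice k ⟨hu' d hd, B.toTransducer.init_mem_reachable ?_⟩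
      rw [← eq_initConfig ⟨q, d, hd⟩]
      exact Transf.apply_eq_some.2 ⟨_, hm, rfl⟩)
  choose stepMove hstep using fun (a : Fin s) (k : Fin L.length) => exists_lift (γ := γ)
    (D := Sol (γ k)) ((B.step a).spec (ι k)) (fun r u hu => by
      obtain ⟨hu', hm⟩ := Transf.spec_eq_some.1 hu
      -- A reachable datum at the source state witnesses that the target state is reached.
      obtain ⟨⟨q, d, hd⟩, hx, hq⟩ := hreached k
      obtain rfl : q = ι k := hq
      exact hsurj _ (B.toTransducer.step_mem_reachable (a := a) hx
        (Transf.apply_eq_some.2 ⟨_, hm, rfl⟩))) (fun k' u hu d hd => by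
      obtain ⟨hu', hm⟩ := Transf.spec_eq_some.1 hu
      -- The source domain is the closure of reachable data, which the update sends to reachable
      -- data, so by continuity the whole domain lands in the target closure.
      rw [hcl] at hd
      refine eval_mem_sol_of_mem_cl (fun d' hd' => ?_) hd
      exact hslice k' ⟨hu' d' hd'.1, B.toTransducer.step_mem_reachable (a := a) hd'.2
        (Transf.apply_eq_some.2 ⟨_, hm, rfl⟩)⟩)
  let K : FinSpace Γ U := ⟨L.length, fun k => B.space.rank (ι k), eqs⟩
  let C : FinTransducer Γ U s :=
    ⟨K, ⟨initMove⟩, fun a => ⟨stepMove a⟩, B.halt.restrictDom hγ⟩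
  have hofFn : ∀ {β : Type} (g : ℕ → β), (stateCodes U B.code).map g =
      List.ofFn fun k : Fin L.length => g (ι k).1 := by
    intro β g
    rw [← hL, List.map_map, ← List.ofFn_getElem_eq_map]
    rfl
  refine ⟨C, ?_, ?_⟩
  · refine Prod.ext rfl (Prod.ext ?_ (Prod.ext ?_ (Prod.ext ?_ ?_)))
    · refine (hofFn _).trans (congrArg List.ofFn (funext fun k => ?_))
      refine Prod.ext ?_ (heqs k).symm
      have h1 : B.code.2.1[(ι k).1]? =
          some (B.space.rank (ι k), (B.space.eqs (ι k)).map Equation.code) := by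
        simp [FinTransducer.code, FinSpace.code]
      rw [h1]
      rfl
    · change B.init.code.map _ = Transf.code (X := initSpace Γ U) (Y := K) ⟨initMove⟩
      rw [Transf.code_eq_spec, List.map_ofFn, Transf.code, ← hL]
      refine congrArg List.ofFn (funext fun q => ?_)
      rw [Function.comp_apply, ← hinit]
      exact relabelCode_map hnodup _
    · change (List.ofFn fun a => (B.step a).code).map _ =
        List.ofFn fun a => Transf.code (X := K) (Y := K) ⟨stepMove a⟩
      rw [List.map_ofFn]
      refine congrArg List.ofFn (funext fun a => ?_)
      refine (hofFn _).trans (congrArg List.ofFn (funext fun k => ?_))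
      have h1 : (B.step a).code[(ι k).1]?.getD none =
          ((B.step a).spec (ι k)).map fun m => (Fin.val m.1, m.2.code) := by
        rw [Transf.code_eq_spec]
        simp
      rw [h1, ← hstep, ← hL]
      exact relabelCode_map hnodup _
    · refine (hofFn _).trans ?_
      change _ = Transf.code (X := K) (Y := haltSpace Γ U) (B.halt.restrictDom hγ)
      rw [Transf.code_eq_spec]
      refine congrArg List.ofFn (funext fun k => ?_)
      have h1 : B.halt.code[(ι k).1]?.getD none =
          (B.halt.spec (ι k)).map fun m => (Fin.val m.1, m.2.code) := by
        rw [Transf.code_eq_spec]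
        simp
      refine h1.trans ?_
      exact congrArg _ (Transf.restrictDom_spec hγ B.halt k).symm
  · refine isInitialImage_restrict B.toTransducer (ι := ι) (γ := γ) hγ hι ?_ hcl
      (init := ⟨initMove⟩) (step := fun a => ⟨stepMove a⟩) (fun x => ?_) (fun a x => ?_)
    · ext q
      constructor
      · rintro ⟨k, rfl⟩
        exact hreached k
      · rintro ⟨x, hx, rfl⟩
        exact hsurj x hx
    · exact Transf.map_incl_apply hγ (hinit x.1)
    · refine (Transf.map_incl_apply (Y := B.space.toSpace) (ι := ι) (γ := γ) hγ
        (f := Transf.restrictDom (Y := B.space.toSpace) hγ (B.step a)) ?_).trans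
        (Transf.restrictDom_apply (Y := B.space.toSpace) (ι := ι) (γ := γ) hγ (B.step a) x)
      exact (hstep a x.1).trans
        (Transf.restrictDom_spec (Y := B.space.toSpace) (ι := ι) hγ (B.step a) x.1).symm

end

end UpwardSTT

theorem mainTheorem9 (U : UpwardSTT.UpdateClass) :
    (∃ F : UpwardSTT.TransducerCode → UpwardSTT.TransducerCode, Computable F ∧
      ∀ (Γ : UpwardSTT.RankedAlphabet) (s : ℕ) (B : UpwardSTT.FinTransducer Γ U s),
        ∃ C : UpwardSTT.FinTransducer Γ U s,
          F B.code = C.code ∧ UpwardSTT.IsInitialImage C.toTransducer B.toTransducer) ∧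
    (∀ (Γ : UpwardSTT.RankedAlphabet) (s : ℕ) (B : UpwardSTT.FinTransducer Γ U s),
      IsLeast (Function.fixedPoints B.toTransducer.invariantStep)
        (B.toTransducer.space.closure B.toTransducer.reachable) ∧
      ∃ N : ℕ, B.toTransducer.invariantStep^[N] ∅ =
        B.toTransducer.space.closure B.toTransducer.reachable) :=
  ⟨⟨UpwardSTT.imageCode U, (UpwardSTT.primrec_imageCode U).to_comp,
    fun _ _ B => UpwardSTT.exists_initialImage B⟩,
    fun _ _ B => ⟨B.toTransducer.isLeast_closure_reachable,
      -- The number of iterations is one more than the word length at which the closure is attained.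
      _, (B.toTransducer.iterate_invariantStep _).trans
        (UpwardSTT.closure_reachedWithin_eq_closure_reachable B)⟩⟩
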